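/- Let $A$ be a separable unital $C^*$-algebra, $G$ a countable discrete group and $\gamma : G \to \operatorname{Aut}(A)$ an action. Let $A \rtimes_\gamma G$ denote either the full or the reduced crossed product, generated by the canonical copy of $A$ and unitaries $u_g$, $g \in G$, forming a representation of $G$ with $u_g a u_g^* = \gamma_g(a)$. Let $g \mapsto D_g$ be a map from $G$ into the self-adjoint elements of the center of $A$ such that $\gamma_{h^{-1}}(D_g) + D_h = D_{gh}$ for all $g,h \in G$, and let $\alpha^D$ be the flow on $A \rtimes_\gamma G$ determined by $$\alpha^D_t(a u_g) = a u_g e^{-itD_g}, \qquad a \in A,\ g \in G,\ t \in \mathbb R .$$ Let $\beta \in \mathbb R$. Let $S_\beta(A \rtimes_\gamma G)$ be the set of $\beta$-KMS states for $\alpha^D$, i.e. the states $\omega$ with $\omega(ba) = \omega(a\,\alpha^D_{i\beta}(b))$ for all $a \in A \rtimes_\gamma G$ and all $b$ in a dense $\alpha^D$-invariant $*$-subalgebra of $\alpha^D$-analytic elements (elements $b$ for which $t \mapsto \alpha^D_t(b)$ extends to a holomorphic map $z \mapsto \alpha^D_z(b)$ on $\mathbb C$). Let $T_\beta(A)$ be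 the set of trace states $\tau$ on $A$ with $\tau(\gamma_g(a)) = \tau(a e^{\beta D_g})$ for all $a \in A$ and $g \in G$. Write $\partial_e$ for the set of extreme points of a convex set. Then: 1. If $\omega \in \partial_e S_\beta(A \rtimes_\gamma G)$, then $\omega|_A \in \partial_e T_\beta(A)$. 2. For every $\tau \in \partial_e T_\beta(A)$ there is an $\omega \in \partial_e S_\beta(A \rtimes_\gamma G)$ such that $\omega|_A = \tau$. -/

import Mathlib

open scoped ComplexOrder ENNReal CStarAlgebra

universe u v w

noncomputable section

/-! ### Flows and KMS states on unital C⋆-algebras -/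

section KMS

variable {B : Type w} [CStarAlgebra B]

/-- A flow on `B`: a point-wise norm-continuous representation of `ℝ` by automorphisms of `B`. -/
structure CStarFlow (B : Type w) [CStarAlgebra B] where
  /-- the representation, `t ↦ α_t` -/
  toHom : Multiplicative ℝ →* (B ≃⋆ₐ[ℂ] B)
  continuous_apply : ∀ b : B, Continuous fun t : ℝ => toHom (Multiplicative.ofAdd t) b

/-- The automorphism `α_t`. -/
def CStarFlow.aut (α : CStarFlow B) (t : ℝ) : B ≃⋆ₐ[ℂ] B := α.toHom (Multiplicative.ofAdd t)

/-- `f : ℂ → B` is a holomorphic extension of the orbit map `t ↦ α_t(b)` to `ℂ`; then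
`f z = α_z(b)`. Such an `f` is unique if it exists. -/
def CStarFlow.IsEntireExtension (α : CStarFlow B) (b : B) (f : ℂ → B) : Prop :=
  Differentiable ℂ f ∧ ∀ t : ℝ, f (t : ℂ) = α.aut t b

/-- States of a unital C⋆-algebra: positive linear functionals taking the value `1` at `1`. -/
def IsState (ω : B →L[ℂ] ℂ) : Prop :=
  (∀ b : B, 0 ≤ ω (star b * b)) ∧ ω 1 = 1

/-- `β`-KMS states: `ω(ba) = ω(a α_{iβ}(b))` for all `a ∈ B` and all `b` in a dense
`α`-invariant `⋆`-subalgebra of `α`-analytic elements. -/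
def IsKMSState (α : CStarFlow B) (β : ℝ) (ω : B →L[ℂ] ℂ) : Prop :=
  IsState ω ∧ ∃ S : NonUnitalStarSubalgebra ℂ B, Dense (S : Set B) ∧
    (∀ t : ℝ, ∀ b ∈ S, α.aut t b ∈ S) ∧
    ∀ b ∈ S, ∃ f : ℂ → B, α.IsEntireExtension b f ∧
      ∀ a : B, ω (b * a) = ω (a * f (Complex.I * (β : ℂ)))

/-- The set `S_β(B)` of `β`-KMS states for `α`. -/
def kmsStates (α : CStarFlow B) (β : ℝ) : Set (B →L[ℂ] ℂ) := {ω | IsKMSState α β ω}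

end KMS

/-! ### Crossed products by discrete groups -/

section Crossed

variable {A : Type u} {G : Type v} [CStarAlgebra A] [Group G]

/-- A covariant representation of the C⋆-dynamical system `(A, G, γ)` on a (non-zero) Hilbert
space: a unital `⋆`-representation `π` of `A` and a unitary representation `U` of `G` with
`U_g π(a) U_g⋆ = π(γ_g(a))`. -/
structure CovariantRep (γ : G →* (A ≃⋆ₐ[ℂ] A)) where
  /-- the Hilbert space -/
  H : Type (max u v)
  [normed : NormedAddCommGroup H]
  [inner : InnerProductSpace ℂ H]
  [complete : CompleteSpace H]
  [nontriv : Nontrivial H]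
  /-- the representation of the algebra -/
  π : A →⋆ₐ[ℂ] (H →L[ℂ] H)
  /-- the representation of the group -/
  U : G →* unitary (H →L[ℂ] H)
  covariant : ∀ (g : G) (a : A),
    (U g : H →L[ℂ] H) * π a * star (U g : H →L[ℂ] H) = π (γ g a)

attribute [instance] CovariantRep.normed CovariantRep.inner CovariantRep.complete
  CovariantRep.nontriv

/-- `R` is (unitarily equivalent to) the regular covariant representation on `ℓ²(G, K)` induced
by some representation `ρ` of `A` on a Hilbert space `K`:
`(π(a)ξ)(h) = ρ(γ_{h⁻¹}(a)) ξ(h)` and `(U_g ξ)(h) = ξ(g⁻¹h)`. -/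
def CovariantRep.IsRegular {γ : G →* (A ≃⋆ₐ[ℂ] A)} (R : CovariantRep γ) : Prop :=
  ∃ (K : Type u) (_ : NormedAddCommGroup K) (_ : InnerProductSpace ℂ K) (_ : CompleteSpace K)
    (ρ : A →⋆ₐ[ℂ] (K →L[ℂ] K)) (W : R.H ≃ₗᵢ[ℂ] lp (fun _ : G => K) 2),
    (∀ (a : A) (ξ : R.H) (h : G),
      W (R.π a ξ) h = ρ (γ h⁻¹ a) (W ξ h)) ∧
    ∀ (g : G) (ξ : R.H) (h : G),
      W ((R.U g : R.H →L[ℂ] R.H) ξ) h = W ξ (g⁻¹ * h)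

/-- The two crossed products of `(A, G, γ)`. -/
inductive CrossedKind where
  | full
  | reduced

/-- The covariant representations that define the norm of the crossed product: all of them for
the full crossed product, the regular ones for the reduced crossed product. -/
def CovariantRep.Admissible {γ : G →* (A ≃⋆ₐ[ℂ] A)} (k : CrossedKind) (R : CovariantRep γ) :
    Prop :=
  match k with
  | .full => True
  | .reduced => R.IsRegular

/-- The index type of all admissible covariant representations. -/
abbrev AdmissibleRep (γ : G →* (A ≃⋆ₐ[ℂ] A)) (k : CrossedKind) :=
  {R : CovariantRep γ // R.Admissible k}

/-- The C⋆-algebra of bounded families `(T_R)_R`, `T_R ∈ B(H_R)`, indexed by the admissible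
covariant representations, with the supremum norm. -/
abbrev BoundedFamilies (γ : G →* (A ≃⋆ₐ[ℂ] A)) (k : CrossedKind) :=
  lp (fun R : AdmissibleRep γ k => R.1.H →L[ℂ] R.1.H) ∞

instance (γ : G →* (A ≃⋆ₐ[ℂ] A)) (k : CrossedKind) : CStarAlgebra (BoundedFamilies γ k) where

/-- `a ↦ (π_R(a))_R`. -/
def familyOfAlg (γ : G →* (A ≃⋆ₐ[ℂ] A)) (k : CrossedKind) : A →⋆ₐ[ℂ] BoundedFamilies γ k where
  toFun a := ⟨fun R => R.1.π a, memℓp_infty ⟨‖a‖, by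
    rintro _ ⟨R, rfl⟩
    exact NonUnitalStarAlgHom.norm_apply_le R.1.π a⟩⟩
  map_one' := by ext R : 2; exact map_one R.1.π
  map_mul' a b := by ext R : 2; exact map_mul R.1.π a b
  map_zero' := by ext R : 2; exact map_zero R.1.π
  map_add' a b := by ext R : 2; exact map_add R.1.π a b
  commutes' c := by ext R : 2; exact AlgHomClass.commutes R.1.π c
  map_star' a := by ext R : 2; exact map_star R.1.π a

/-- `g ↦ (U_{R,g})_R`. -/
def familyOfGroup (γ : G →* (A ≃⋆ₐ[ℂ] A)) (k : CrossedKind) (g : G) : BoundedFamilies γ k :=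
  ⟨fun R => (R.1.U g : R.1.H →L[ℂ] R.1.H), memℓp_infty ⟨1, by
    rintro _ ⟨R, rfl⟩
    exact (CStarRing.norm_coe_unitary (R.1.U g)).le⟩⟩

/-- The crossed product, as the C⋆-algebra generated by the elements `(π_R(a))_R`, `a ∈ A`, and
`(U_{R,g})_R`, `g ∈ G`, in the algebra of bounded families. It is the completion of the
`⋆`-algebra of finite sums `∑ a_g u_g` in the norm `sup_R ‖∑ π_R(a_g) U_{R,g}‖`, where `R` runs
through all covariant representations (full crossed product) or through the regular ones
(reduced crossed product). -/
def crossedProductSubalgebra (γ : G →* (A ≃⋆ₐ[ℂ] A)) (k : CrossedKind) :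
    StarSubalgebra ℂ (BoundedFamilies γ k) :=
  (StarAlgebra.adjoin ℂ
    (Set.range (familyOfAlg γ k) ∪ Set.range (familyOfGroup γ k))).topologicalClosure

/-- The crossed product `A ⋊_γ G`, full or reduced. -/
def CrossedProduct (γ : G →* (A ≃⋆ₐ[ℂ] A)) (k : CrossedKind) :=
  ↥(crossedProductSubalgebra γ k)

instance (γ : G →* (A ≃⋆ₐ[ℂ] A)) (k : CrossedKind) :
    IsClosed (crossedProductSubalgebra γ k : Set (BoundedFamilies γ k)) :=
  StarSubalgebra.isClosed_topologicalClosure _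

instance (γ : G →* (A ≃⋆ₐ[ℂ] A)) (k : CrossedKind) : CStarAlgebra (CrossedProduct γ k) :=
  inferInstanceAs (CStarAlgebra ↥(crossedProductSubalgebra γ k))

theorem familyOfAlg_mem (γ : G →* (A ≃⋆ₐ[ℂ] A)) (k : CrossedKind) (a : A) :
    familyOfAlg γ k a ∈ crossedProductSubalgebra γ k :=
  StarSubalgebra.le_topologicalClosure _
    (StarAlgebra.subset_adjoin ℂ _ (Or.inl ⟨a, rfl⟩))

theorem familyOfGroup_mem (γ : G →* (A ≃⋆ₐ[ℂ] A)) (k : CrossedKind) (g : G) :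
    familyOfGroup γ k g ∈ crossedProductSubalgebra γ k :=
  StarSubalgebra.le_topologicalClosure _
    (StarAlgebra.subset_adjoin ℂ _ (Or.inr ⟨g, rfl⟩))

/-- The canonical copy of `A` in `A ⋊_γ G`. -/
def algIncl (γ : G →* (A ≃⋆ₐ[ℂ] A)) (k : CrossedKind) : A →⋆ₐ[ℂ] CrossedProduct γ k :=
  (familyOfAlg γ k).codRestrict (crossedProductSubalgebra γ k) (familyOfAlg_mem γ k)

/-- The canonical unitaries `u_g` in `A ⋊_γ G`. -/
def canonicalUnitary (γ : G →* (A ≃⋆ₐ[ℂ] A)) (k : CrossedKind) (g : G) : CrossedProduct γ k :=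
  ⟨familyOfGroup γ k g, familyOfGroup_mem γ k g⟩

/-- Restriction of a functional on `A ⋊_γ G` to `A`. -/
def restrictToAlg {γ : G →* (A ≃⋆ₐ[ℂ] A)} {k : CrossedKind}
    (ω : CrossedProduct γ k →L[ℂ] ℂ) : A →L[ℂ] ℂ :=
  ω.comp ⟨(algIncl γ k).toAlgHom.toLinearMap, by
    exact (map_continuous (algIncl γ k))⟩

/-! ### The cocycle `D`, its flow, and the conformal trace states -/

/-- A map `g ↦ D_g` from `G` to the self-adjoint central elements of `A` with
`γ_{h⁻¹}(D_g) + D_h = D_{gh}`. -/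
structure CentralCocycle (γ : G →* (A ≃⋆ₐ[ℂ] A)) where
  /-- `g ↦ D_g` -/
  toFun : G → A
  isSelfAdjoint : ∀ g, IsSelfAdjoint (toFun g)
  commute : ∀ (g : G) (a : A), Commute (toFun g) a
  cocycle : ∀ g h : G, γ h⁻¹ (toFun g) + toFun h = toFun (g * h)

instance (γ : G →* (A ≃⋆ₐ[ℂ] A)) : CoeFun (CentralCocycle γ) fun _ => G → A :=
  ⟨CentralCocycle.toFun⟩

namespace CentralCocycle

variable {γ : G →* (A ≃⋆ₐ[ℂ] A)} (D : CentralCocycle γ)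

/-- The unitary `e^{-itD_g}`. -/
def phase (t : ℝ) (g : G) : A := NormedSpace.exp ((-(Complex.I * (t : ℂ))) • D g)

theorem phase_commute (t : ℝ) (g : G) (a : A) : Commute (D.phase t g) a := by
  let _ : NormedAlgebra ℚ A := NormedAlgebra.restrictScalars ℚ ℂ A
  exact ((D.commute g a).smul_left _).exp_left

theorem phase_zero (g : G) : D.phase 0 g = 1 := by simp [phase]

theorem phase_add (s t : ℝ) (g : G) : D.phase (s + t) g = D.phase s g * D.phase t g := by
  let _ : NormedAlgebra ℚ A := NormedAlgebra.restrictScalars ℚ ℂ A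
  unfold phase
  rw [← NormedSpace.exp_add_of_commute (((D.commute g (D g)).smul_left _).smul_right _),
    ← add_smul]
  congr 2
  push_cast
  ring

theorem star_phase (t : ℝ) (g : G) : star (D.phase t g) = D.phase (-t) g := by
  unfold phase
  rw [NormedSpace.star_exp, star_smul, (D.isSelfAdjoint g).star_eq]
  congr 2
  simp

theorem phase_mul_neg (t : ℝ) (g : G) : D.phase t g * D.phase (-t) g = 1 := by
  rw [← phase_add, add_neg_cancel, phase_zero]

theorem phase_neg_mul (t : ℝ) (g : G) : D.phase (-t) g * D.phase t g = 1 := by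
  rw [← phase_add, neg_add_cancel, phase_zero]

theorem phase_cocycle (t : ℝ) (g h : G) :
    γ h⁻¹ (D.phase t g) * D.phase t h = D.phase t (g * h) := by
  let _ : NormedAlgebra ℚ A := NormedAlgebra.restrictScalars ℚ ℂ A
  have h1 : γ h⁻¹ (D.phase t g) =
      NormedSpace.exp ((-(Complex.I * (t : ℂ))) • γ h⁻¹ (D g)) := by
    unfold phase
    rw [← map_smul (γ h⁻¹)]
    exact NormedSpace.map_exp (γ h⁻¹) (map_continuous (γ h⁻¹)) _
  have hc : Commute (γ h⁻¹ (D g)) (D h) := (D.commute h _).symm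
  rw [h1]
  unfold phase
  rw [← NormedSpace.exp_add_of_commute ((hc.smul_left _).smul_right _), ← smul_add,
    D.cocycle]

theorem continuous_phase (g : G) : Continuous fun t : ℝ => D.phase t g := by
  let _ : NormedAlgebra ℚ A := NormedAlgebra.restrictScalars ℚ ℂ A
  unfold phase
  exact NormedSpace.exp_continuous.comp (by fun_prop)

/-- `e^{-itD_g}` as an element of the unitary group. -/
def phaseUnitary (t : ℝ) (g : G) : unitary A :=
  ⟨D.phase t g, by
    rw [Unitary.mem_iff, star_phase]
    exact ⟨D.phase_neg_mul t g, D.phase_mul_neg t g⟩⟩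

end CentralCocycle

namespace CovariantRep

variable {γ : G →* (A ≃⋆ₐ[ℂ] A)} (D : CentralCocycle γ)

theorem U_mul_π (R : CovariantRep γ) (g : G) (a : A) :
    (R.U g : R.H →L[ℂ] R.H) * R.π a = R.π (γ g a) * (R.U g : R.H →L[ℂ] R.H) := by
  rw [← R.covariant g a, mul_assoc, Unitary.coe_star_mul_self, mul_one]

/-- The twist `(π, U) ↦ (π, U^t)` with `U^t_g = U_g π(e^{-itD_g})`. -/
def twist (t : ℝ) (R : CovariantRep γ) : CovariantRep γ where
  H := R.H
  π := R.π
  U := MonoidHom.mk' (fun g => R.U g *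
    ⟨R.π (D.phase t g), Unitary.map_mem R.π (D.phaseUnitary t g).2⟩) (by
    intro g h
    ext1
    change (R.U (g * h) : R.H →L[ℂ] R.H) * R.π (D.phase t (g * h)) =
      ((R.U g : R.H →L[ℂ] R.H) * R.π (D.phase t g)) *
        ((R.U h : R.H →L[ℂ] R.H) * R.π (D.phase t h))
    have h1 : R.π (D.phase t g) * (R.U h : R.H →L[ℂ] R.H) =
        (R.U h : R.H →L[ℂ] R.H) * R.π (γ h⁻¹ (D.phase t g)) := by
      rw [R.U_mul_π]
      congr 2
      rw [← StarAlgEquiv.mul_apply, ← map_mul]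
      simp
    rw [mul_assoc, ← mul_assoc (R.π _), h1, mul_assoc, ← map_mul, D.phase_cocycle, map_mul,
      ← mul_assoc]
    rfl)
  covariant g a := by
    change ((R.U g : R.H →L[ℂ] R.H) * R.π (D.phase t g)) * R.π a *
      star ((R.U g : R.H →L[ℂ] R.H) * R.π (D.phase t g)) = _
    rw [star_mul, ← map_star, D.star_phase, ← R.covariant g a]
    have h1 : R.π (D.phase t g) * R.π a * R.π (D.phase (-t) g) = R.π a := by
      rw [← map_mul, (D.phase_commute t g a).eq, ← map_mul, mul_assoc, D.phase_mul_neg, mul_one]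
    calc _ = (R.U g : R.H →L[ℂ] R.H) *
          (R.π (D.phase t g) * R.π a * R.π (D.phase (-t) g)) *
            star (R.U g : R.H →L[ℂ] R.H) := by simp only [mul_assoc]
      _ = _ := by rw [h1]

theorem twist_U (t : ℝ) (R : CovariantRep γ) (g : G) :
    ((R.twist D t).U g : (R.twist D t).H →L[ℂ] (R.twist D t).H) =
      (R.U g : R.H →L[ℂ] R.H) * R.π (D.phase t g) := rfl

theorem twist_zero (R : CovariantRep γ) (g : G) : (R.twist D 0).U g = R.U g := by
  ext1
  rw [twist_U, D.phase_zero, map_one, mul_one]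

theorem twist_add (s t : ℝ) (R : CovariantRep γ) (g : G) :
    ((R.twist D s).twist D t).U g = (R.twist D (s + t)).U g := by
  ext1
  rw [twist_U, twist_U, twist_U, D.phase_add, map_mul, ← mul_assoc]
  rfl

/-- The pointwise multiplication of `ℓ²(G, K)` by the unitaries `ρ(e^{-itD_h})`, `h ∈ G`. -/
def diagonal {K : Type u} [NormedAddCommGroup K] [InnerProductSpace ℂ K] [CompleteSpace K]
    (ρ : A →⋆ₐ[ℂ] (K →L[ℂ] K)) (t : ℝ) :
    lp (fun _ : G => K) 2 ≃ₗᵢ[ℂ] lp (fun _ : G => K) 2 :=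
  have hn : ∀ (t : ℝ) (h : G) (x : K), ‖ρ (D.phase t h) x‖ = ‖x‖ := fun t h x =>
    ContinuousLinearMap.norm_map_of_mem_unitary
      (Unitary.map_mem ρ (D.phaseUnitary t h).2) x
  have hm : ∀ (t : ℝ) (f : lp (fun _ : G => K) 2),
      Memℓp (fun h => ρ (D.phase t h) (f h)) 2 := fun t f => by
    refine memℓp_gen ?_
    have := (lp.memℓp f).summable (by norm_num)
    simpa only [hn] using this
  have hi : ∀ (t : ℝ) (h : G) (x : K), ρ (D.phase t h) (ρ (D.phase (-t) h) x) = x :=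
    fun t h x => by
      rw [← mul_apply_eq_comp, ← map_mul, D.phase_mul_neg, map_one]
      rfl
  { toFun := fun f => ⟨fun h => ρ (D.phase t h) (f h), hm t f⟩
    invFun := fun f => ⟨fun h => ρ (D.phase (-t) h) (f h), hm (-t) f⟩
    map_add' := fun f g => by ext h; exact map_add _ _ _
    map_smul' := fun c f => by ext h; exact map_smul _ _ _
    left_inv := fun f => by
      ext h
      have := hi (-t) h (f h)
      rw [neg_neg] at this
      exact this
    right_inv := fun f => by ext h; exact hi t h _
    norm_map' := fun f => by
      rw [lp.norm_eq_tsum_rpow (by norm_num), lp.norm_eq_tsum_rpow (by norm_num)]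
      congr 1
      refine tsum_congr fun h => ?_
      congr 1
      exact hn t h _ }

theorem diagonal_apply {K : Type u} [NormedAddCommGroup K] [InnerProductSpace ℂ K]
    [CompleteSpace K] (ρ : A →⋆ₐ[ℂ] (K →L[ℂ] K)) (t : ℝ) (f : lp (fun _ : G => K) 2) (h : G) :
    diagonal D ρ t f h = ρ (D.phase t h) (f h) := rfl

theorem IsRegular.twist {R : CovariantRep γ} (hR : R.IsRegular) (t : ℝ) :
    (R.twist D t).IsRegular := by
  obtain ⟨K, i1, i2, i3, ρ, W, h1, h2⟩ := hR
  refine ⟨K, i1, i2, i3, ρ, W.trans (diagonal D ρ (-t)), fun a (ξ : R.H) h => ?_,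
    fun g (ξ : R.H) h => ?_⟩
  · change ρ (D.phase (-t) h) (W (R.π a ξ) h) = ρ (γ h⁻¹ a) (ρ (D.phase (-t) h) (W ξ h))
    rw [h1, ← mul_apply_eq_comp, ← mul_apply_eq_comp, ← map_mul, ← map_mul,
      (D.phase_commute _ _ _).eq]
  · change ρ (D.phase (-t) h) (W ((R.U g : R.H →L[ℂ] R.H) (R.π (D.phase t g) ξ)) h) =
      ρ (D.phase (-t) (g⁻¹ * h)) (W ξ (g⁻¹ * h))
    rw [h2, h1, ← mul_apply_eq_comp, ← map_mul]
    congr 2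
    have hc := D.phase_cocycle t g (g⁻¹ * h)
    rw [mul_inv_cancel_left] at hc
    calc D.phase (-t) h * γ (g⁻¹ * h)⁻¹ (D.phase t g)
        = D.phase (-t) h * (γ (g⁻¹ * h)⁻¹ (D.phase t g) *
            (D.phase t (g⁻¹ * h) * D.phase (-t) (g⁻¹ * h))) := by
          rw [D.phase_mul_neg, mul_one]
      _ = (D.phase (-t) h * D.phase t h) * D.phase (-t) (g⁻¹ * h) := by
          rw [← mul_assoc (γ _ _), hc, mul_assoc]
      _ = _ := by rw [D.phase_neg_mul, one_mul]

theorem Admissible.twist {k : CrossedKind} {R : CovariantRep γ} (hR : R.Admissible k) (t : ℝ) :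
    (R.twist D t).Admissible k := by
  cases k with
  | full => trivial
  | reduced => exact IsRegular.twist D hR t

end CovariantRep

section FlowConstruction

variable {γ : G →* (A ≃⋆ₐ[ℂ] A)} (D : CentralCocycle γ) (k : CrossedKind)

/-- Twisting, as a map on the index type. -/
def twistIndex (t : ℝ) (R : AdmissibleRep γ k) : AdmissibleRep γ k :=
  ⟨R.1.twist D t, R.2.twist D t⟩

/-- The `⋆`-homomorphism `(T_R)_R ↦ (T_{R^t})_R`, where `R^t = (π, U^t)` is the twist of
`R = (π, U)`. -/
def twistFamilies (t : ℝ) : BoundedFamilies γ k →⋆ₐ[ℂ] BoundedFamilies γ k where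
  toFun x := ⟨fun R => (x (twistIndex D k t R) : R.1.H →L[ℂ] R.1.H), memℓp_infty ⟨‖x‖, by
    rintro _ ⟨R, rfl⟩
    exact lp.norm_apply_le_norm ENNReal.top_ne_zero x (twistIndex D k t R)⟩⟩
  map_one' := rfl
  map_mul' _ _ := rfl
  map_zero' := rfl
  map_add' _ _ := rfl
  commutes' _ := rfl
  map_star' _ := rfl

theorem twistFamilies_apply (t : ℝ) (x : BoundedFamilies γ k) (R : AdmissibleRep γ k) :
    twistFamilies D k t x R = (x (twistIndex D k t R) : R.1.H →L[ℂ] R.1.H) := rfl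

theorem twistFamilies_alg (t : ℝ) (a : A) :
    twistFamilies D k t (familyOfAlg γ k a) = familyOfAlg γ k a := rfl

theorem twistFamilies_group (t : ℝ) (g : G) :
    twistFamilies D k t (familyOfGroup γ k g) =
      familyOfGroup γ k g * familyOfAlg γ k (D.phase t g) := rfl

/-- A family takes equal values at representations with equal components. -/
theorem family_congr (x : BoundedFamilies γ k) (R : CovariantRep γ)
    (U₁ U₂ : G →* unitary (R.H →L[ℂ] R.H)) (c₁ c₂)
    (h₁ : CovariantRep.Admissible k (⟨R.H, R.π, U₁, c₁⟩ : CovariantRep γ))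
    (h₂ : CovariantRep.Admissible k (⟨R.H, R.π, U₂, c₂⟩ : CovariantRep γ)) (h : U₁ = U₂) :
    (x ⟨⟨R.H, R.π, U₁, c₁⟩, h₁⟩ : R.H →L[ℂ] R.H) = x ⟨⟨R.H, R.π, U₂, c₂⟩, h₂⟩ := by
  subst h
  rfl

theorem twistFamilies_zero (x : BoundedFamilies γ k) : twistFamilies D k 0 x = x := by
  ext R : 2
  exact family_congr k x R.1 _ _ _ R.1.covariant (R.2.twist D 0) R.2
    (MonoidHom.ext fun g => R.1.twist_zero D g)

theorem twistFamilies_add (s t : ℝ) (x : BoundedFamilies γ k) :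
    twistFamilies D k (s + t) x = twistFamilies D k s (twistFamilies D k t x) := by
  ext R : 2
  exact (family_congr k x R.1 _ _ _ _ ((R.2.twist D s).twist D t) (R.2.twist D (s + t))
    (MonoidHom.ext fun g => R.1.twist_add D s t g)).symm

theorem twistFamilies_mem (t : ℝ) {x : BoundedFamilies γ k}
    (hx : x ∈ crossedProductSubalgebra γ k) :
    twistFamilies D k t x ∈ crossedProductSubalgebra γ k := by
  have hc : Continuous (twistFamilies D k t) := map_continuous _
  have hcl : IsClosed (crossedProductSubalgebra γ k : Set (BoundedFamilies γ k)) := inferInstance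
  have hle : StarAlgebra.adjoin ℂ
      (Set.range (familyOfAlg γ k) ∪ Set.range (familyOfGroup γ k)) ≤
      (crossedProductSubalgebra γ k).comap (twistFamilies D k t) := by
    refine StarAlgebra.adjoin_le ?_
    rintro _ (⟨a, rfl⟩ | ⟨g, rfl⟩)
    · exact familyOfAlg_mem γ k a
    · exact mul_mem (familyOfGroup_mem γ k g) (familyOfAlg_mem γ k _)
  exact StarSubalgebra.topologicalClosure_minimal hle (hcl.preimage hc) hx

theorem continuous_twistFamilies {x : BoundedFamilies γ k}
    (hx : x ∈ crossedProductSubalgebra γ k) :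
    Continuous fun t : ℝ => twistFamilies D k t x := by
  have key : ∀ y ∈ StarAlgebra.adjoin ℂ
      (Set.range (familyOfAlg γ k) ∪ Set.range (familyOfGroup γ k)),
      Continuous fun t : ℝ => twistFamilies D k t y := by
    intro y hy
    induction hy using StarAlgebra.adjoin_induction with
    | mem y hy =>
      rcases hy with ⟨a, rfl⟩ | ⟨g, rfl⟩
      · simp only [twistFamilies_alg]
        exact continuous_const
      · simp only [twistFamilies_group]
        exact continuous_const.mul
          ((map_continuous (familyOfAlg γ k)).comp (D.continuous_phase g))
    | algebraMap r =>
      simp only [AlgHomClass.commutes]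
      exact continuous_const
    | add y z _ _ hy hz => simp only [map_add]; exact hy.add hz
    | mul y z _ _ hy hz => simp only [map_mul]; exact hy.mul hz
    | star y _ hy => simp only [map_star]; exact hy.star
  refine continuous_of_uniform_approx_of_continuous fun u hu => ?_
  obtain ⟨ε, hε, hεu⟩ := Metric.mem_uniformity_dist.1 hu
  obtain ⟨y, hy, hxy⟩ := Metric.mem_closure_iff.1 hx ε hε
  refine ⟨_, key y hy, fun t => hεu ?_⟩
  rw [dist_eq_norm, ← map_sub]
  refine lt_of_le_of_lt (NonUnitalStarAlgHom.norm_apply_le (twistFamilies D k t) _) ?_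
  rwa [← dist_eq_norm]

/-- The flow `α^D` on `A ⋊_γ G`; it is determined by
`α^D_t(a u_g) = a u_g e^{-itD_g}`, see `cocycleFlow_apply`. -/
def cocycleFlow : CStarFlow (CrossedProduct γ k) where
  toHom := MonoidHom.mk' (fun t =>
    { toFun := fun x => ⟨twistFamilies D k t.toAdd x.1, twistFamilies_mem D k t.toAdd x.2⟩
      invFun := fun x => ⟨twistFamilies D k (-t.toAdd) x.1, twistFamilies_mem D k (-t.toAdd) x.2⟩
      left_inv := fun x => Subtype.ext (by
        change twistFamilies D k (-t.toAdd) (twistFamilies D k t.toAdd x.1) = x.1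
        rw [← twistFamilies_add, neg_add_cancel, twistFamilies_zero])
      right_inv := fun x => Subtype.ext (by
        change twistFamilies D k t.toAdd (twistFamilies D k (-t.toAdd) x.1) = x.1
        rw [← twistFamilies_add, add_neg_cancel, twistFamilies_zero])
      map_mul' := fun x y => Subtype.ext (map_mul (twistFamilies D k t.toAdd) x.1 y.1)
      map_add' := fun x y => Subtype.ext (map_add (twistFamilies D k t.toAdd) x.1 y.1)
      map_star' := fun x => Subtype.ext (map_star (twistFamilies D k t.toAdd) x.1)
      map_smul' := fun c x => Subtype.ext (map_smul (twistFamilies D k t.toAdd) c x.1) })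
    (fun s t => StarAlgEquiv.ext fun x =>
      Subtype.ext (twistFamilies_add D k s.toAdd t.toAdd x.1))
  continuous_apply b := (continuous_twistFamilies D k b.2).subtype_mk _

theorem cocycleFlow_apply (t : ℝ) (a : A) (g : G) :
    (cocycleFlow D k).aut t (algIncl γ k a * canonicalUnitary γ k g) =
      algIncl γ k a * canonicalUnitary γ k g *
        algIncl γ k (NormedSpace.exp ((-(Complex.I * (t : ℂ))) • D g)) := by
  refine Subtype.ext ?_
  change twistFamilies D k t (familyOfAlg γ k a * familyOfGroup γ k g) =
    familyOfAlg γ k a * familyOfGroup γ k g * familyOfAlg γ k (D.phase t g)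
  rw [map_mul, twistFamilies_alg, twistFamilies_group, mul_assoc]

/-- The canonical unitaries implement the action: `u_g a u_g⋆ = γ_g(a)`. -/
theorem canonicalUnitary_covariant (g : G) (a : A) :
    canonicalUnitary γ k g * algIncl γ k a * star (canonicalUnitary γ k g) =
      algIncl γ k (γ g a) := by
  refine Subtype.ext ?_
  change familyOfGroup γ k g * familyOfAlg γ k a * star (familyOfGroup γ k g) =
    familyOfAlg γ k (γ g a)
  ext R : 2
  exact R.1.covariant g a

end FlowConstruction

/-- `T_β(A)`: the trace states `τ` of `A` with `τ(γ_g(a)) = τ(a e^{β D_g})` for all `a`, `g`. -/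
def conformalTraceStates {γ : G →* (A ≃⋆ₐ[ℂ] A)} (D : CentralCocycle γ) (β : ℝ) :
    Set (A →L[ℂ] ℂ) :=
  {τ | IsState τ ∧ (∀ a b : A, τ (a * b) = τ (b * a)) ∧
    ∀ (g : G) (a : A), τ (γ g a) = τ (a * NormedSpace.exp ((β : ℂ) • D g))}

end Crossed
end

/-! Restriction to `A` maps `S_β` affinely and weak-* continuously onto `T_β`. The definition of a
KMS state lets the dense subalgebra depend on the state; `IsKMSState.apply_mul` removes this freedom
by a three lines argument, so the KMS condition amounts to closed identities for the elements `a
u_g` (`mem_kmsStates_cocycleFlow_iff`). Hence `S_β` is weak-* compact.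

Surjectivity onto `T_β` comes from the regular representation induced by the GNS representation of
`τ`: the vector state at `δ_1 ⊗ ξ_τ` extends `τ` and vanishes on `a u_g` for `g ≠ 1`, which makes it
KMS. Extreme points of the image of a compact set lift through a continuous affine map by
Krein-Milman, and this is the second claim.

The first claim is a Radon-Nikodym argument carried out in `L²(A, τ)`, where `τ = ω|_A`. If `τ = sσ₁
+ tσ₂` in `T_β`, each `σᵢ` is bounded in the 2-norm and is therefore a limit of functionals `τ(a_n
·)` with `a_n ≥ 0` in `A` and `(a_n)` Cauchy in 2-norm
(`PositiveLinearMap.exists_seq_nonneg_tendsto`). As `σᵢ` and `τ` obey the same conformality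
relation, `(a_n)` asymptotically commutes with every `c u_g` (`tendsto_toPreGNS_commutator`), so `x
↦ lim ω(a_n x)` is again a KMS state, and it extends `σᵢ` (`exists_isKMSState_of_le`). The two
extensions average to `ω`; extremality of `ω` identifies them with `ω`, whence `σᵢ = τ`. -/

noncomputable section

open Filter Topology UniformSpace
open scoped InnerProductSpace

/-! ### Weak and norm convergence in pre-Hilbert spaces -/

section InnerProduct

/-- A Cauchy sequence in a pre-Hilbert space that converges weakly to `0` converges to `0`. -/
theorem tendsto_zero_of_cauchySeq_of_inner {E : Type*} [SeminormedAddCommGroup E]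
    [InnerProductSpace ℂ E] {x : ℕ → E} (hx : CauchySeq x)
    (h : ∀ y : E, Tendsto (fun n => ⟪y, x n⟫_ℂ) atTop (𝓝 0)) : Tendsto x atTop (𝓝 0) := by
  obtain ⟨η, hη⟩ := cauchySeq_tendsto_of_complete
    ((Completion.uniformContinuous_coe E).comp_cauchySeq hx)
  -- The limit in the completion is orthogonal to a dense subspace, hence zero.
  have h0 : ∀ y : Completion E, ⟪y, η⟫_ℂ = 0 := by
    intro y
    induction y using Completion.induction_on with
    | hp => exact isClosed_eq (by fun_prop) continuous_const
    | ih y =>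
      refine tendsto_nhds_unique ((Continuous.tendsto (f := fun z : Completion E =>
        ⟪(y : Completion E), z⟫_ℂ) (by fun_prop) η).comp hη) ?_
      simpa [Function.comp_def, Completion.inner_coe] using h y
  have : η = 0 := inner_self_eq_zero.1 (h0 η)
  subst this
  rw [tendsto_zero_iff_norm_tendsto_zero] at hη ⊢
  simpa [Function.comp_def, Completion.norm_coe] using hη

end InnerProduct

/-! ### The GNS seminorm of a state, and Radon-Nikodym approximation for a trace -/

namespace PositiveLinearMap

variable {A : Type*} [CStarAlgebra A] [PartialOrder A] [StarOrderedRing A] (f : A →ₚ[ℂ] ℂ)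

theorem norm_toPreGNS_sq (a : A) : ‖f.toPreGNS a‖ ^ 2 = (f (star a * a)).re := by
  have := congrArg Complex.re (f.preGNS_norm_sq (f.toPreGNS a))
  rw [ofPreGNS_toPreGNS] at this
  rw [← this]
  norm_cast

theorem inner_toPreGNS (a b : A) : ⟪f.toPreGNS a, f.toPreGNS b⟫_ℂ = f (star a * b) := rfl

/-- The Cauchy-Schwarz inequality. -/
theorem norm_apply_star_mul_le (a b : A) :
    ‖f (star a * b)‖ ≤ ‖f.toPreGNS a‖ * ‖f.toPreGNS b‖ :=
  norm_inner_le_norm (𝕜 := ℂ) (f.toPreGNS a) (f.toPreGNS b)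

theorem norm_toPreGNS_mul_le (a b : A) : ‖f.toPreGNS (a * b)‖ ≤ ‖a‖ * ‖f.toPreGNS b‖ :=
  (f.leftMulMapPreGNS a).le_of_opNorm_le
    (LinearMap.mkContinuous_norm_le _ (norm_nonneg a) _) (f.toPreGNS b)

theorem norm_toPreGNS_one (hf : f 1 = 1) : ‖f.toPreGNS 1‖ = 1 := by
  have := f.norm_toPreGNS_sq 1
  rw [star_one, mul_one, hf, Complex.one_re] at this
  exact (pow_eq_one_iff_of_nonneg (norm_nonneg _) two_ne_zero).1 this

theorem norm_toPreGNS_le (hf : f 1 = 1) (a : A) : ‖f.toPreGNS a‖ ≤ ‖a‖ := by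
  simpa [f.norm_toPreGNS_one hf] using f.norm_toPreGNS_mul_le a 1

theorem norm_apply_le (hf : f 1 = 1) (a : A) : ‖f a‖ ≤ ‖a‖ := by
  have := f.norm_apply_star_mul_le 1 a
  rw [star_one, one_mul, f.norm_toPreGNS_one hf, one_mul] at this
  exact this.trans (f.norm_toPreGNS_le hf a)

section Trace

variable (hf : ∀ a b : A, f (a * b) = f (b * a))
include hf

theorem norm_toPreGNS_star (a : A) : ‖f.toPreGNS (star a)‖ = ‖f.toPreGNS a‖ := by
  rw [← sq_eq_sq₀ (norm_nonneg _) (norm_nonneg _), norm_toPreGNS_sq, norm_toPreGNS_sq,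
    star_star, hf]

/-- The adjoint is isometric for a trace and turns right multiplication into left multiplication. -/
theorem norm_toPreGNS_mul_right_le (a b : A) : ‖f.toPreGNS (a * b)‖ ≤ ‖b‖ * ‖f.toPreGNS a‖ := by
  rw [← f.norm_toPreGNS_star hf, star_mul, ← f.norm_toPreGNS_star hf a, ← norm_star b]
  exact f.norm_toPreGNS_mul_le _ _

/-- A positive functional that is bounded in the norm of a trace is implemented by a limit of
positive elements. -/
theorem exists_seq_nonneg_tendsto (σ : A →ₗ[ℂ] ℂ) (hσ : ∀ a, 0 ≤ a → 0 ≤ σ a) {C : ℝ}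
    (hC : ∀ a, ‖σ a‖ ≤ C * ‖f.toPreGNS a‖) :
    ∃ a : ℕ → A, (∀ n, 0 ≤ a n) ∧ CauchySeq (fun n => f.toPreGNS (a n)) ∧
      ∀ x, Tendsto (fun n => f (a n * x)) atTop (𝓝 (σ x)) := by
  have hstar : ∀ a, σ (star a) = star (σ a) := fun a => map_star (PositiveLinearMap.mk₀ σ hσ) a
  -- `ξ` is the Riesz vector of `σ`; it remains to approximate it by positive elements of `A`.
  obtain ⟨ξ, hξ⟩ : ∃ ξ : f.GNS, ∀ x : A, ⟪ξ, (f.toPreGNS x : f.GNS)⟫_ℂ = σ x := by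
    let φ : f.PreGNS →L[ℂ] ℂ := (σ ∘ₗ f.ofPreGNS.toLinearMap).mkContinuous C fun x => hC x
    let e : f.PreGNS →L[ℂ] f.GNS := Completion.toComplL
    refine ⟨(InnerProductSpace.toDual ℂ f.GNS).symm (φ.extend e), fun x => ?_⟩
    rw [InnerProductSpace.toDual_symm_apply]
    exact ContinuousLinearMap.extend_eq φ Completion.denseRange_coe
      (Completion.isUniformInducing_coe _) (f.toPreGNS x)
  have hsq : ∀ x : A, ‖ξ - f.toPreGNS x‖ ^ 2 =
      ‖ξ‖ ^ 2 - 2 * (σ x).re + ‖f.toPreGNS x‖ ^ 2 := fun x => by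
    rw [@norm_sub_sq ℂ, hξ, Completion.norm_coe]
    rfl
  -- Since `σ` is hermitian, replacing an approximant by its self-adjoint part does not increase the
  -- distance to `ξ`.
  have hsym : ∀ x : A, ‖ξ - f.toPreGNS (star x)‖ = ‖ξ - f.toPreGNS x‖ := fun x => by
    rw [← sq_eq_sq₀ (norm_nonneg _) (norm_nonneg _), hsq, hsq, hstar,
      f.norm_toPreGNS_star hf]
    simp
  have hpos : ∀ x : A, IsSelfAdjoint x →
      ‖ξ - f.toPreGNS (x⁺)‖ ≤ 2 * ‖ξ - f.toPreGNS x‖ := by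
    intro x hx
    have h1 : x = x⁺ - x⁻ := (CFC.posPart_sub_negPart x hx).symm
    have hn : IsSelfAdjoint (x⁻) := (CFC.negPart_nonneg x).isSelfAdjoint
    have h2 : ⟪(f.toPreGNS x : f.GNS), (f.toPreGNS (x⁻) : f.GNS)⟫_ℂ = - f (x⁻ * x⁻) := by
      rw [Completion.inner_coe, inner_toPreGNS, hx.star_eq]
      nth_rw 1 [h1]
      rw [sub_mul, CFC.posPart_mul_negPart, zero_sub, map_neg]
    -- The inner product of `ξ - x` with `x⁻` is `σ(x⁻) + f(x⁻x⁻)`. Its first term is nonnegative,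
    -- so Cauchy-Schwarz bounds `x⁻` by the distance from `x` to `ξ`.
    have h3 : ‖f.toPreGNS (x⁻)‖ ^ 2 ≤ ‖ξ - f.toPreGNS x‖ * ‖f.toPreGNS (x⁻)‖ := by
      have h4 : (⟪ξ - f.toPreGNS x, (f.toPreGNS (x⁻) : f.GNS)⟫_ℂ).re ≤
          ‖ξ - f.toPreGNS x‖ * ‖f.toPreGNS (x⁻)‖ := by
        rw [← Completion.norm_coe (f.toPreGNS (x⁻))]
        exact re_inner_le_norm (𝕜 := ℂ) _ _
      rw [inner_sub_left, hξ, h2] at h4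
      have h5 := (Complex.le_def.1 (hσ _ (CFC.negPart_nonneg x))).1
      rw [norm_toPreGNS_sq, hn.star_eq]
      simp at h4 h5
      linarith
    have h6 : ‖f.toPreGNS (x⁻)‖ ≤ ‖ξ - f.toPreGNS x‖ := by
      rcases (norm_nonneg (f.toPreGNS (x⁻))).eq_or_lt with h | h
      · rw [← h]; exact norm_nonneg _
      · rw [sq] at h3
        exact le_of_mul_le_mul_right h3 h
    calc ‖ξ - f.toPreGNS (x⁺)‖ = ‖(ξ - f.toPreGNS x) - f.toPreGNS (x⁻)‖ := by
          congr 1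
          nth_rw 2 [h1]
          rw [map_sub, Completion.coe_sub]
          abel
      _ ≤ ‖ξ - f.toPreGNS x‖ + ‖f.toPreGNS (x⁻)‖ := by
          rw [← Completion.norm_coe (f.toPreGNS (x⁻))]
          exact norm_sub_le _ _
      _ ≤ _ := by linarith
  have happ : ∀ n : ℕ, ∃ a : A, 0 ≤ a ∧ ‖ξ - f.toPreGNS a‖ < 1 / ((n : ℝ) + 1) := by
    intro n
    -- Half the tolerance, because passing to the positive part may double the distance.
    have hε : (0 : ℝ) < 1 / ((n : ℝ) + 1) / 2 := by positivity
    obtain ⟨y, hy⟩ := Completion.denseRange_coe.exists_dist_lt ξ hε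
    rw [dist_eq_norm] at hy
    let a : A := f.ofPreGNS y
    let x : A := (2⁻¹ : ℂ) • (a + star a)
    have hx : IsSelfAdjoint x := by
      refine IsSelfAdjoint.smul ?_ (IsSelfAdjoint.add_star_self a)
      simp [isSelfAdjoint_iff]
    have h7 : ‖ξ - f.toPreGNS x‖ < 1 / ((n : ℝ) + 1) / 2 := by
      have h8 : ξ - f.toPreGNS x = (2⁻¹ : ℂ) • ((ξ - f.toPreGNS a) +
          (ξ - f.toPreGNS (star a))) := by
        simp only [x, map_smul, map_add, Completion.coe_smul, Completion.coe_add]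
        module
      rw [h8, norm_smul]
      have h9 : ‖(ξ - f.toPreGNS a) + (ξ - f.toPreGNS (star a))‖ ≤
          ‖ξ - f.toPreGNS a‖ + ‖ξ - f.toPreGNS a‖ :=
        (norm_add_le _ _).trans (by rw [hsym])
      have h10 : ‖ξ - f.toPreGNS a‖ < 1 / ((n : ℝ) + 1) / 2 := hy
      simp only [norm_inv, RCLike.norm_ofNat]
      linarith
    exact ⟨x⁺, CFC.posPart_nonneg x, (hpos x hx).trans_lt (by linarith)⟩
  choose a ha0 ha using happ
  have hlim : Tendsto (fun n => (f.toPreGNS (a n) : f.GNS)) atTop (𝓝 ξ) := by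
    rw [tendsto_iff_norm_sub_tendsto_zero]
    refine squeeze_zero (fun _ => norm_nonneg _) (fun n => ?_)
      tendsto_one_div_add_atTop_nhds_zero_nat
    rw [norm_sub_rev]
    exact (ha n).le
  refine ⟨a, ha0, ?_, fun x => ?_⟩
  · have := hlim.cauchySeq
    exact (Completion.isUniformInducing_coe f.PreGNS).cauchy_map_iff.1
      (by rwa [Filter.map_map])
  · have := (Continuous.tendsto (f := fun z : f.GNS =>
      ⟪z, (f.toPreGNS x : f.GNS)⟫_ℂ) (by fun_prop) ξ).comp hlim
    rw [hξ] at this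
    refine this.congr fun n => ?_
    simp only [Function.comp_apply, Completion.inner_coe, inner_toPreGNS,
      (ha0 n).isSelfAdjoint.star_eq]

end Trace

end PositiveLinearMap

/-! ### States as positive linear maps -/

section States

variable {B : Type*} [CStarAlgebra B]

theorem IsState.nonneg [PartialOrder B] [StarOrderedRing B] {ω : B →L[ℂ] ℂ} (hω : IsState ω)
    {b : B} (hb : 0 ≤ b) : 0 ≤ ω b := by
  obtain ⟨c, rfl⟩ := CStarAlgebra.nonneg_iff_eq_star_mul_self.1 hb
  exact hω.1 c

/-- A state as a positive linear map. -/
def IsState.toPositiveLinearMap [PartialOrder B] [StarOrderedRing B] {ω : B →L[ℂ] ℂ}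
    (hω : IsState ω) : B →ₚ[ℂ] ℂ :=
  PositiveLinearMap.mk₀ ω.toLinearMap fun _ hb => hω.nonneg hb

theorem IsState.toPositiveLinearMap_apply [PartialOrder B] [StarOrderedRing B] {ω : B →L[ℂ] ℂ}
    (hω : IsState ω) (b : B) : hω.toPositiveLinearMap b = ω b := rfl

theorem IsState.norm_apply_le {ω : B →L[ℂ] ℂ} (hω : IsState ω) (b : B) : ‖ω b‖ ≤ ‖b‖ := by
  let _ := CStarAlgebra.spectralOrder B
  have _ := CStarAlgebra.spectralOrderedRing B
  exact hω.toPositiveLinearMap.norm_apply_le hω.2 b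

end States

/-! ### Entire orbit maps, and the KMS condition for all entire elements -/

section Flow

variable {B : Type*} [CStarAlgebra B]

/-- Entire functions that agree on the real line are equal. -/
theorem Differentiable.eq_of_eqOn_real {E : Type*} [NormedAddCommGroup E] [NormedSpace ℂ E]
    [CompleteSpace E] {f g : ℂ → E} (hf : Differentiable ℂ f) (hg : Differentiable ℂ g)
    (h : ∀ t : ℝ, f t = g t) : f = g := by
  refine AnalyticOnNhd.eq_of_frequently_eq (z₀ := ((0 : ℝ) : ℂ))
    (fun z _ => hf.analyticAt z) (fun z _ => hg.analyticAt z) ?_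
  have ht : Tendsto (fun t : ℝ => (t : ℂ)) (𝓝[≠] 0) (𝓝[≠] ((0 : ℝ) : ℂ)) :=
    tendsto_nhdsWithin_of_tendsto_nhds_of_eventually_within _
      ((Complex.continuous_ofReal.tendsto 0).mono_left nhdsWithin_le_nhds)
      (eventually_nhdsWithin_of_forall fun t ht => by simpa using ht)
  exact ht.frequently (Eventually.of_forall h).frequently

namespace CStarFlow

variable (α : CStarFlow B)

theorem norm_aut (t : ℝ) (b : B) : ‖α.aut t b‖ = ‖b‖ :=
  NonUnitalStarAlgHom.norm_map (α.aut t) (α.aut t).injective b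

theorem aut_add (s t : ℝ) (b : B) : α.aut (s + t) b = α.aut s (α.aut t b) := by
  unfold aut
  rw [ofAdd_add, map_mul]
  rfl

variable {α} {b c : B} {f g : ℂ → B}

theorem IsEntireExtension.eq (hf : α.IsEntireExtension b f) (hg : α.IsEntireExtension b g) :
    f = g :=
  hf.1.eq_of_eqOn_real hg.1 fun t => (hf.2 t).trans (hg.2 t).symm

theorem IsEntireExtension.sub (hf : α.IsEntireExtension b f) (hg : α.IsEntireExtension c g) :
    α.IsEntireExtension (b - c) (fun z => f z - g z) :=
  ⟨hf.1.sub hg.1, fun t => by simp only [hf.2, hg.2, map_sub]⟩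

theorem IsEntireExtension.aut (hf : α.IsEntireExtension b f) (t : ℝ) :
    α.IsEntireExtension (α.aut t b) (fun z => f (z + t)) :=
  ⟨hf.1.comp (differentiable_id.add_const _), fun s => by
    rw [← α.aut_add, ← hf.2, Complex.ofReal_add]⟩

/-- Both sides, as functions of `z`, are entire extensions of the orbit of `α_t(b)`, so uniqueness
applies. -/
theorem IsEntireExtension.apply_add_real (hf : α.IsEntireExtension b f) (z : ℂ) (t : ℝ) :
    f (z + t) = α.aut t (f z) := by
  let T : B →L[ℂ] B := ⟨(α.aut t : B →ₗ[ℂ] B), (map_continuous (α.aut t))⟩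
  have h : α.IsEntireExtension (α.aut t b) (fun z => α.aut t (f z)) :=
    ⟨T.differentiable.comp hf.1, fun s => by
      simp only [hf.2, ← α.aut_add, add_comm]⟩
  exact congrFun ((hf.aut t).eq h) z

theorem IsEntireExtension.apply_I_mul (hf : α.IsEntireExtension b f) (β : ℝ) (w : ℂ) :
    f (Complex.I * β * w) = α.aut (-(β * w.im)) (f (Complex.I * β * w.re)) := by
  rw [← hf.apply_add_real]
  congr 1
  apply Complex.ext <;> simp

/-- Moving `w` vertically only applies an isometry `α_t`, so boundedness on the strip reduces to a
compact interval. This is the a priori bound the three lines theorem requires. -/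
theorem IsEntireExtension.exists_norm_le (hf : α.IsEntireExtension b f) (β : ℝ) :
    ∃ M, ∀ w : ℂ, w.re ∈ Set.Icc (0 : ℝ) 1 → ‖f (Complex.I * β * w)‖ ≤ M := by
  have hc : ContinuousOn (fun s : ℝ => f (Complex.I * β * s)) (Set.Icc 0 1) :=
    (hf.1.continuous.comp (by fun_prop)).continuousOn
  obtain ⟨M, hM⟩ := isCompact_Icc.exists_bound_of_continuousOn hc
  refine ⟨M, fun w hw => ?_⟩
  rw [hf.apply_I_mul, α.norm_aut]
  exact hM _ hw

/-- The three lines theorem for `w ↦ ω (a * f (iβw))`. -/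
theorem IsEntireExtension.norm_le_interp (hf : α.IsEntireExtension b f) (β : ℝ) (ω : B →L[ℂ] ℂ)
    (a : B) {C₀ C₁ : ℝ} (h0 : ∀ t : ℝ, ‖ω (a * f t)‖ ≤ C₀)
    (h1 : ∀ t : ℝ, ‖ω (a * f (Complex.I * β + t))‖ ≤ C₁) {s : ℝ} (hs : s ∈ Set.Icc (0 : ℝ) 1) :
    ‖ω (a * f (Complex.I * β * s))‖ ≤ C₀ ^ (1 - s) * C₁ ^ s := by
  obtain ⟨M, hM⟩ := hf.exists_norm_le β
  have hd : Differentiable ℂ fun w : ℂ => ω (a * f (Complex.I * β * w)) :=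
    (ω.comp (ContinuousLinearMap.mul ℂ B a)).differentiable.comp
      (hf.1.comp (differentiable_id.const_mul _))
  have := Complex.HadamardThreeLines.norm_le_interp_of_mem_verticalClosedStrip₀₁'
    (fun w : ℂ => ω (a * f (Complex.I * β * w))) (z := (s : ℂ)) (a := C₀) (b := C₁)
    (by simpa [Complex.HadamardThreeLines.verticalClosedStrip] using hs) hd.diffContOnCl ?_ ?_ ?_
  · simpa using this
  · refine ⟨‖ω‖ * (‖a‖ * M), ?_⟩
    rintro _ ⟨w, hw, rfl⟩
    refine (ω.le_opNorm _).trans ?_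
    gcongr
    refine (norm_mul_le _ _).trans ?_
    gcongr
    exact hM w hw
  · intro w hw
    have hw : w.re = 0 := hw
    have e : Complex.I * β * w = ((-(β * w.im) : ℝ) : ℂ) := by
      apply Complex.ext <;> simp [hw]
    simpa only [e] using h0 (-(β * w.im))
  · intro w hw
    have hw : w.re = 1 := hw
    have e : Complex.I * β * w = Complex.I * β + ((-(β * w.im) : ℝ) : ℂ) := by
      apply Complex.ext <;> simp [hw]
    simpa only [e] using h1 (-(β * w.im))

end CStarFlow

variable {α : CStarFlow B} {β : ℝ} {ω : B →L[ℂ] ℂ}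

/-- The KMS condition holds for every element with an entire orbit map. -/
theorem IsKMSState.apply_mul (hω : IsKMSState α β ω) {c : B} {f : ℂ → B}
    (hf : α.IsEntireExtension c f) (a : B) : ω (c * a) = ω (a * f (Complex.I * β)) := by
  obtain ⟨hst, S, hdense, hinv, hS⟩ := hω
  -- Invariance of `S` allows the KMS identity to be applied to `α_t(b)`; this controls the whole
  -- far edge of the strip.
  have hKMS : ∀ b ∈ S, ∀ g : ℂ → B, α.IsEntireExtension b g → ∀ t : ℝ,
      ω (a * g (Complex.I * β + t)) = ω (α.aut t b * a) := by
    intro b hb g hg t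
    obtain ⟨g', hg', h⟩ := hS _ (hinv t b hb)
    rw [h, hg'.eq (hg.aut t)]
  have hbd : ∀ x y : B, ‖ω (x * y)‖ ≤ ‖x‖ * ‖y‖ := fun x y =>
    (hst.norm_apply_le _).trans (norm_mul_le _ _)
  have hreal : ∀ b g, α.IsEntireExtension b g → ∀ t : ℝ, ‖ω (a * g t)‖ ≤ ‖a‖ * ‖b‖ := by
    intro b g hg t
    refine (hbd _ _).trans ?_
    rw [hg.2, α.norm_aut]
  have hstrip : ∀ b ∈ S, ∀ g : ℂ → B, α.IsEntireExtension b g → ∀ s ∈ Set.Icc (0 : ℝ) 1,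
      ‖ω (a * g (Complex.I * β * s))‖ ≤ ‖a‖ * ‖b‖ := by
    intro b hb g hg s hs
    refine (hg.norm_le_interp β ω a (hreal b g hg) (C₁ := ‖a‖ * ‖b‖) (fun t => ?_) hs).trans ?_
    · rw [hKMS b hb g hg]
      refine (hbd _ _).trans ?_
      rw [α.norm_aut, mul_comm]
    · rw [← Real.rpow_add' (by positivity) (by simp)]
      simp
  obtain ⟨x, hxS, hx⟩ := mem_closure_iff_seq_limit.1 (hdense c)
  choose g hg hgω using fun n => hS (x n) (hxS n)
  obtain ⟨M, hM⟩ := hf.exists_norm_le β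
  -- The KMS identity is not yet available for `c`, so nothing small is known for `x m - c` on the
  -- far edge, only boundedness. For `s < 1` the small near edge enters with the positive exponent
  -- `1 - s`, and letting `m → ∞` removes that term.
  have hlt : ∀ n, ∀ s ∈ Set.Ioo (0 : ℝ) 1,
      ‖ω (a * g n (Complex.I * β * s)) - ω (a * f (Complex.I * β * s))‖ ≤
        ‖a‖ * ‖x n - c‖ := by
    intro n s hs
    have hb : ∀ m, ‖ω (a * g n (Complex.I * β * s)) - ω (a * f (Complex.I * β * s))‖ ≤
        ‖a‖ * ‖x n - x m‖ +
          (‖a‖ * ‖x m - c‖) ^ (1 - s) * (‖a‖ * ‖x m‖ + ‖a‖ * M) ^ s := by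
      intro m
      have e1 := hstrip _ (sub_mem (hxS n) (hxS m)) _ ((hg n).sub (hg m)) s ⟨hs.1.le, hs.2.le⟩
      have e2 := ((hg m).sub hf).norm_le_interp β ω a (hreal _ _ ((hg m).sub hf))
        (C₁ := ‖a‖ * ‖x m‖ + ‖a‖ * M) (fun t => ?_) ⟨hs.1.le, hs.2.le⟩
      · simp only [mul_sub, map_sub] at e1 e2
        exact (norm_sub_le_norm_sub_add_norm_sub _ _ _).trans (add_le_add e1 e2)
      · rw [mul_sub, map_sub, hKMS _ (hxS m) _ (hg m)]
        refine (norm_sub_le _ _).trans (add_le_add ?_ ?_)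
        · refine (hbd _ _).trans ?_
          rw [α.norm_aut, mul_comm]
        · refine (hbd _ _).trans ?_
          gcongr
          rw [hf.apply_add_real, α.norm_aut]
          simpa using hM 1 (by simp)
    have hn : Tendsto (fun m => ‖x m - c‖) atTop (𝓝 0) := tendsto_iff_norm_sub_tendsto_zero.1 hx
    have hlim : Tendsto (fun m => ‖a‖ * ‖x n - x m‖ +
          (‖a‖ * ‖x m - c‖) ^ (1 - s) * (‖a‖ * ‖x m‖ + ‖a‖ * M) ^ s) atTop
        (𝓝 (‖a‖ * ‖x n - c‖ + (‖a‖ * 0) ^ (1 - s) * (‖a‖ * ‖c‖ + ‖a‖ * M) ^ s)) := by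
      refine ((hx.const_sub _).norm.const_mul _).add (Tendsto.mul ?_ ?_)
      · exact (hn.const_mul _).rpow_const (Or.inr (by linarith [hs.2]))
      · exact ((hx.norm.const_mul _).add_const _).rpow_const (Or.inr hs.1.le)
    rw [mul_zero, Real.zero_rpow (by linarith [hs.2]), zero_mul, add_zero] at hlim
    exact ge_of_tendsto' hlim hb
  have hle : ∀ n, ‖ω (x n * a) - ω (a * f (Complex.I * β))‖ ≤ ‖a‖ * ‖x n - c‖ := by
    intro n
    rw [hgω]
    -- The estimate for `s < 1` does not depend on `s`, so continuity carries it to `s = 1`.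
    have hcont : Continuous fun s : ℝ =>
        ‖ω (a * g n (Complex.I * β * s)) - ω (a * f (Complex.I * β * s))‖ := by
      have h1 := (hg n).1.continuous
      have h2 := hf.1.continuous
      fun_prop
    have h := hcont.tendsto 1
    simp only [Complex.ofReal_one, mul_one] at h
    refine le_of_tendsto (h.mono_left (nhdsWithin_le_nhds (s := Set.Iio 1))) ?_
    filter_upwards [Ioo_mem_nhdsLT (zero_lt_one' ℝ)] with s hs using hlt n s hs
  have hl1 : Tendsto (fun n => ω (x n * a)) atTop (𝓝 (ω (c * a))) :=
    (ω.continuous.tendsto _).comp (hx.mul_const a)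
  have hl2 : Tendsto (fun n => ω (x n * a)) atTop (𝓝 (ω (a * f (Complex.I * β)))) := by
    rw [tendsto_iff_norm_sub_tendsto_zero]
    refine squeeze_zero (fun _ => norm_nonneg _) hle ?_
    simpa using (tendsto_iff_norm_sub_tendsto_zero.1 hx).const_mul ‖a‖
  exact tendsto_nhds_unique hl1 hl2

end Flow

/-! ### The dense `⋆`-algebra spanned by the `a u_g`, and the KMS condition on it -/

section CrossedAlgebra

variable {A : Type u} {G : Type v} [CStarAlgebra A] [Group G]
variable (γ : G →* (A ≃⋆ₐ[ℂ] A)) (k : CrossedKind)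

theorem canonicalUnitary_mul (g h : G) :
    canonicalUnitary γ k (g * h) = canonicalUnitary γ k g * canonicalUnitary γ k h := by
  refine Subtype.ext ?_
  change familyOfGroup γ k (g * h) = familyOfGroup γ k g * familyOfGroup γ k h
  ext R : 2
  change ((R.1.U (g * h) : unitary _) : R.1.H →L[ℂ] R.1.H) = R.1.U g * R.1.U h
  rw [map_mul]
  rfl

theorem canonicalUnitary_one : canonicalUnitary γ k (1 : G) = 1 := by
  refine Subtype.ext ?_
  change familyOfGroup γ k 1 = 1
  ext R : 2
  change ((R.1.U 1 : unitary _) : R.1.H →L[ℂ] R.1.H) = 1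
  rw [map_one]
  rfl

theorem star_canonicalUnitary (g : G) :
    star (canonicalUnitary γ k g) = canonicalUnitary γ k g⁻¹ := by
  refine Subtype.ext ?_
  change star (familyOfGroup γ k g) = familyOfGroup γ k g⁻¹
  ext R : 2
  change star ((R.1.U g : unitary _) : R.1.H →L[ℂ] R.1.H) = (R.1.U g⁻¹ : unitary _)
  rw [map_inv]
  rfl

theorem canonicalUnitary_mul_algIncl (g : G) (a : A) :
    canonicalUnitary γ k g * algIncl γ k a = algIncl γ k (γ g a) * canonicalUnitary γ k g := by
  rw [← canonicalUnitary_covariant k g a, star_canonicalUnitary,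
    mul_assoc _ (canonicalUnitary γ k g⁻¹), ← canonicalUnitary_mul, inv_mul_cancel,
    canonicalUnitary_one, mul_one]

theorem monomial_mul (a b : A) (g h : G) :
    algIncl γ k a * canonicalUnitary γ k g * (algIncl γ k b * canonicalUnitary γ k h) =
      algIncl γ k (a * γ g b) * canonicalUnitary γ k (g * h) := by
  rw [mul_assoc, ← mul_assoc (canonicalUnitary γ k g), canonicalUnitary_mul_algIncl,
    canonicalUnitary_mul, map_mul]
  simp only [mul_assoc]

theorem star_monomial (a : A) (g : G) :
    star (algIncl γ k a * canonicalUnitary γ k g) =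
      algIncl γ k (γ g⁻¹ (star a)) * canonicalUnitary γ k g⁻¹ := by
  rw [star_mul, star_canonicalUnitary, ← map_star, canonicalUnitary_mul_algIncl]

/-- The linear span of the elements `a u_g` in the crossed product. -/
def crossedSpan : Submodule ℂ (CrossedProduct γ k) :=
  Submodule.span ℂ (Set.range fun p : A × G => algIncl γ k p.1 * canonicalUnitary γ k p.2)

variable {γ k}

theorem monomial_mem_crossedSpan (a : A) (g : G) :
    algIncl γ k a * canonicalUnitary γ k g ∈ crossedSpan γ k :=
  Submodule.subset_span ⟨(a, g), rfl⟩

theorem algIncl_mem_crossedSpan (a : A) : algIncl γ k a ∈ crossedSpan γ k := by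
  simpa [canonicalUnitary_one] using monomial_mem_crossedSpan (γ := γ) (k := k) a 1

theorem crossedSpan_induction {p : CrossedProduct γ k → Prop}
    (mono : ∀ (a : A) (g : G), p (algIncl γ k a * canonicalUnitary γ k g)) (zero : p 0)
    (add : ∀ x y, p x → p y → p (x + y)) (smul : ∀ (c : ℂ) x, p x → p (c • x))
    {x : CrossedProduct γ k} (hx : x ∈ crossedSpan γ k) : p x := by
  induction hx using Submodule.span_induction with
  | mem x hx => obtain ⟨⟨a, g⟩, rfl⟩ := hx; exact mono a g
  | zero => exact zero
  | add x y _ _ hx hy => exact add x y hx hy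
  | smul c x _ hx => exact smul c x hx

theorem mul_mem_crossedSpan {x y : CrossedProduct γ k} (hx : x ∈ crossedSpan γ k)
    (hy : y ∈ crossedSpan γ k) : x * y ∈ crossedSpan γ k := by
  refine crossedSpan_induction (p := fun x => x * y ∈ crossedSpan γ k) (fun a g => ?_)
    (by simp) (fun x x' h h' => by rw [add_mul]; exact add_mem h h')
    (fun c x h => by rw [smul_mul_assoc]; exact Submodule.smul_mem _ c h) hx
  refine crossedSpan_induction
    (p := fun y => algIncl γ k a * canonicalUnitary γ k g * y ∈ crossedSpan γ k) (fun b h => ?_)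
    (by simp) (fun x x' h h' => by rw [mul_add]; exact add_mem h h')
    (fun c x h => by rw [mul_smul_comm]; exact Submodule.smul_mem _ c h) hy
  rw [monomial_mul]
  exact monomial_mem_crossedSpan _ _

theorem star_mem_crossedSpan {x : CrossedProduct γ k} (hx : x ∈ crossedSpan γ k) :
    star x ∈ crossedSpan γ k := by
  refine crossedSpan_induction (p := fun x => star x ∈ crossedSpan γ k) (fun a g => ?_)
    (by simp) (fun x x' h h' => by rw [star_add]; exact add_mem h h')
    (fun c x h => by rw [star_smul]; exact Submodule.smul_mem _ _ h) hx
  rw [star_monomial]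
  exact monomial_mem_crossedSpan _ _

variable (γ k) in
/-- The span of the elements `a u_g` as a `⋆`-subalgebra. -/
def crossedSubalgebra : NonUnitalStarSubalgebra ℂ (CrossedProduct γ k) where
  toSubmodule := crossedSpan γ k
  mul_mem' := mul_mem_crossedSpan
  star_mem' := star_mem_crossedSpan

/-- The span contains the generators and is closed under products and adjoints, so it exhausts the
`⋆`-algebra they generate. -/
theorem dense_crossedSpan : Dense (crossedSpan γ k : Set (CrossedProduct γ k)) := by
  have key : ∀ y ∈ StarAlgebra.adjoin ℂ
      (Set.range (familyOfAlg γ k) ∪ Set.range (familyOfGroup γ k)),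
      ∃ s ∈ crossedSpan γ k, s.1 = y := by
    intro y hy
    induction hy using StarAlgebra.adjoin_induction with
    | mem y hy =>
      rcases hy with ⟨a, rfl⟩ | ⟨g, rfl⟩
      · exact ⟨_, algIncl_mem_crossedSpan a, rfl⟩
      · refine ⟨canonicalUnitary γ k g, ?_, rfl⟩
        simpa using monomial_mem_crossedSpan (γ := γ) (k := k) 1 g
    | algebraMap r =>
      refine ⟨algIncl γ k (algebraMap ℂ A r), algIncl_mem_crossedSpan _, ?_⟩
      exact AlgHomClass.commutes (familyOfAlg γ k) r
    | add y z _ _ hy hz =>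
      obtain ⟨s, hs, rfl⟩ := hy
      obtain ⟨t, ht, rfl⟩ := hz
      exact ⟨s + t, add_mem hs ht, rfl⟩
    | mul y z _ _ hy hz =>
      obtain ⟨s, hs, rfl⟩ := hy
      obtain ⟨t, ht, rfl⟩ := hz
      exact ⟨s * t, mul_mem_crossedSpan hs ht, rfl⟩
    | star y _ hy =>
      obtain ⟨s, hs, rfl⟩ := hy
      exact ⟨star s, star_mem_crossedSpan hs, rfl⟩
  intro x
  refine Metric.mem_closure_iff.2 fun ε hε => ?_
  obtain ⟨y, hy, hxy⟩ := Metric.mem_closure_iff.1 (show x.1 ∈ closure _ from x.2) ε hε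
  obtain ⟨s, hs, rfl⟩ := key y hy
  exact ⟨s, hs, hxy⟩

variable (D : CentralCocycle γ)

theorem monomial_isEntireExtension (a : A) (g : G) :
    (cocycleFlow D k).IsEntireExtension (algIncl γ k a * canonicalUnitary γ k g)
      (fun z => algIncl γ k a * canonicalUnitary γ k g *
        algIncl γ k (NormedSpace.exp ((-(Complex.I * z)) • D g))) := by
  refine ⟨?_, fun t => (cocycleFlow_apply D k t a g).symm⟩
  let T : A →L[ℂ] CrossedProduct γ k :=
    ⟨(algIncl γ k).toAlgHom.toLinearMap, map_continuous (algIncl γ k)⟩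
  have h : Differentiable ℂ fun z : ℂ => NormedSpace.exp ((-(Complex.I * z)) • D g) := by
    intro z
    have h1 := hasDerivAt_exp_smul_const (𝕂 := ℂ) (D g) (-(Complex.I * z))
    exact DifferentiableAt.comp (g := fun w : ℂ => NormedSpace.exp (w • D g)) z
      h1.differentiableAt (by fun_prop)
  exact (T.differentiable.comp h).const_mul _

/-- The span of the `a u_g` is flow-invariant and consists of analytic elements, so it serves as the
dense subalgebra; the identity is linear in the analytic element. -/
theorem isKMSState_of_monomial {β : ℝ} {ω : CrossedProduct γ k →L[ℂ] ℂ} (hω : IsState ω)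
    (h : ∀ (a : A) (g : G) (x : CrossedProduct γ k),
      ω (algIncl γ k a * canonicalUnitary γ k g * x) =
        ω (x * (algIncl γ k a * canonicalUnitary γ k g *
          algIncl γ k (NormedSpace.exp ((β : ℂ) • D g))))) :
    IsKMSState (cocycleFlow D k) β ω := by
  refine ⟨hω, crossedSubalgebra γ k, dense_crossedSpan, fun t b hb => ?_, fun b hb => ?_⟩
  · refine crossedSpan_induction
      (p := fun x => (cocycleFlow D k).aut t x ∈ crossedSpan γ k) (fun a g => ?_)
      (by simp) (fun x x' h h' => by rw [map_add]; exact add_mem h h')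
      (fun c x h => by rw [map_smul]; exact Submodule.smul_mem _ _ h) hb
    rw [cocycleFlow_apply]
    exact mul_mem_crossedSpan (monomial_mem_crossedSpan _ _) (algIncl_mem_crossedSpan _)
  · refine crossedSpan_induction
      (p := fun b => ∃ f : ℂ → CrossedProduct γ k, (cocycleFlow D k).IsEntireExtension b f ∧
        ∀ x, ω (b * x) = ω (x * f (Complex.I * (β : ℂ)))) (fun a g => ?_) ?_ ?_ ?_ hb
    · refine ⟨_, monomial_isEntireExtension D a g, fun x => ?_⟩
      rw [h]
      -- At `z = iβ` the exponent `-iz` becomes `β`.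
      simp [← mul_assoc]
    · exact ⟨fun _ => 0, ⟨differentiable_const _, fun t => by simp⟩, fun x => by simp⟩
    · rintro x y ⟨f, hf, hfω⟩ ⟨f', hf', hfω'⟩
      refine ⟨fun z => f z + f' z, ⟨hf.1.add hf'.1, fun t => ?_⟩, fun z => ?_⟩
      · simp only [hf.2, hf'.2, map_add]
      · simp only [add_mul, mul_add, map_add, hfω, hfω']
    · rintro c x ⟨f, hf, hfω⟩
      refine ⟨fun z => c • f z, ⟨hf.1.const_smul c, fun t => ?_⟩, fun z => ?_⟩
      · simp only [hf.2, map_smul]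
      · simp only [smul_mul_assoc, mul_smul_comm, map_smul, hfω]

theorem IsKMSState.monomial_mul {β : ℝ} {ω : CrossedProduct γ k →L[ℂ] ℂ}
    (hω : IsKMSState (cocycleFlow D k) β ω) (a : A) (g : G) (x : CrossedProduct γ k) :
    ω (algIncl γ k a * canonicalUnitary γ k g * x) =
      ω (x * (algIncl γ k a * canonicalUnitary γ k g *
        algIncl γ k (NormedSpace.exp ((β : ℂ) • D g)))) := by
  rw [hω.apply_mul (monomial_isEntireExtension D a g)]
  simp [← mul_assoc]

theorem CentralCocycle.apply_one : D 1 = 0 := by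
  simpa using D.cocycle 1 1

theorem CentralCocycle.exp_commute (z : ℂ) (g : G) (a : A) :
    Commute (NormedSpace.exp (z • D g)) a := by
  let _ : NormedAlgebra ℚ A := NormedAlgebra.restrictScalars ℚ ℂ A
  exact ((D.commute g a).smul_left _).exp_left

variable {D}

/-- The cocycle vanishes at the identity of `G`, so the flow fixes `A` and the KMS condition becomes
a trace property against `A`. -/
theorem IsKMSState.algIncl_mul {β : ℝ} {ω : CrossedProduct γ k →L[ℂ] ℂ}
    (hω : IsKMSState (cocycleFlow D k) β ω) (a : A) (x : CrossedProduct γ k) :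
    ω (algIncl γ k a * x) = ω (x * algIncl γ k a) := by
  simpa [canonicalUnitary_one, D.apply_one] using hω.monomial_mul D a 1 x

theorem restrictToAlg_apply (ω : CrossedProduct γ k →L[ℂ] ℂ) (a : A) :
    restrictToAlg ω a = ω (algIncl γ k a) := rfl

theorem IsState.restrictToAlg {ω : CrossedProduct γ k →L[ℂ] ℂ} (hω : IsState ω) :
    IsState (restrictToAlg ω) := by
  refine ⟨fun a => ?_, ?_⟩
  · rw [restrictToAlg_apply, map_mul, map_star]
    exact hω.1 _
  · rw [restrictToAlg_apply, map_one]
    exact hω.2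

theorem IsKMSState.restrictToAlg_mem {β : ℝ} {ω : CrossedProduct γ k →L[ℂ] ℂ}
    (hω : IsKMSState (cocycleFlow D k) β ω) :
    restrictToAlg ω ∈ conformalTraceStates D β := by
  refine ⟨hω.1.restrictToAlg, fun a b => ?_, fun g a => ?_⟩
  · simp only [restrictToAlg_apply, map_mul]
    exact hω.algIncl_mul a _
  -- Moving `u_g` around `ω(u_g a u_g⋆)` cancels it against `u_g⋆` and leaves the factor `e^{βD_g}`.
  · have h := hω.monomial_mul D 1 g (algIncl γ k a * star (canonicalUnitary γ k g))
    rw [map_one, one_mul, ← mul_assoc, canonicalUnitary_covariant] at h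
    rw [restrictToAlg_apply, restrictToAlg_apply, h, star_canonicalUnitary, map_mul (algIncl γ k)]
    congr 1
    rw [mul_assoc, ← mul_assoc (canonicalUnitary γ k g⁻¹), ← canonicalUnitary_mul,
      inv_mul_cancel, canonicalUnitary_one, one_mul]

end CrossedAlgebra

/-! ### Construction of the regular covariant representations -/

section RegularRepresentation

variable {G : Type v} {K : Type u} [NormedAddCommGroup K] [InnerProductSpace ℂ K]

/-- The diagonal operator on `ℓ²(G, K)` given by a bounded family of operators on `K`. -/
def lpDiagonal (T : G → K →L[ℂ] K) (C : ℝ) (hT : ∀ h, ‖T h‖ ≤ C) :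
    lp (fun _ : G => K) 2 →L[ℂ] lp (fun _ : G => K) 2 :=
  -- One pointwise comparison with `C • f` yields both square summability and the operator bound.
  have hle : ∀ (f : lp (fun _ : G => K) 2) (h : G), ‖T h (f h)‖ ≤ ‖((C : ℂ) • f) h‖ :=
    fun f h => by
      rw [lp.coeFn_smul, Pi.smul_apply, norm_smul, Complex.norm_real]
      exact ((T h).le_of_opNorm_le (hT h) _).trans (by gcongr; exact le_abs_self C)
  LinearMap.mkContinuous
    { toFun := fun f => ⟨fun h => T h (f h), (lp.memℓp ((C : ℂ) • f)).mono' (hle f)⟩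
      map_add' := fun f g => by ext h; exact map_add (T h) _ _
      map_smul' := fun c f => by ext h; exact map_smul (T h) _ _ } ‖(C : ℂ)‖
    fun f => by
      rw [← norm_smul]
      exact lp.norm_mono (by norm_num) (hle f)

theorem lpDiagonal_apply (T : G → K →L[ℂ] K) (C : ℝ) (hT : ∀ h, ‖T h‖ ≤ C)
    (f : lp (fun _ : G => K) 2) (h : G) : lpDiagonal T C hT f h = T h (f h) := rfl

/-- The isometry of `ℓ²(G, K)` given by a permutation of `G`. -/
def lpReindex (e : G ≃ G) : lp (fun _ : G => K) 2 ≃ₗᵢ[ℂ] lp (fun _ : G => K) 2 :=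
  have hm : ∀ (e : G ≃ G) (f : lp (fun _ : G => K) 2), Memℓp (fun h => f (e h)) 2 := fun e f =>
    memℓp_gen (e.summable_iff.2 ((lp.memℓp f).summable (by norm_num)))
  { toFun := fun f => ⟨fun h => f (e h), hm e f⟩
    invFun := fun f => ⟨fun h => f (e.symm h), hm e.symm f⟩
    map_add' := fun f g => rfl
    map_smul' := fun c f => rfl
    left_inv := fun f => by ext h; exact congrArg f (e.apply_symm_apply h)
    right_inv := fun f => by ext h; exact congrArg f (e.symm_apply_apply h)
    norm_map' := fun f => by
      rw [lp.norm_eq_tsum_rpow (by norm_num), lp.norm_eq_tsum_rpow (by norm_num)]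
      congr 1
      exact e.tsum_eq fun h => ‖f h‖ ^ (2 : ℝ≥0∞).toReal }

variable [CompleteSpace K] {A : Type u} [CStarAlgebra A] [Group G] (γ : G →* (A ≃⋆ₐ[ℂ] A))
  (ρ : A →⋆ₐ[ℂ] (K →L[ℂ] K))

/-- The representation `(π(a)ξ)(h) = ρ(γ_{h⁻¹}(a)) ξ(h)` of `A` on `ℓ²(G, K)`. -/
def regularAlg :
    A →⋆ₐ[ℂ] (lp (fun _ : G => K) 2 →L[ℂ] lp (fun _ : G => K) 2) where
  toFun a := lpDiagonal (fun h => ρ (γ h⁻¹ a)) ‖a‖ fun h =>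
    (NonUnitalStarAlgHom.norm_apply_le ρ _).trans
      (NonUnitalStarAlgHom.norm_apply_le (γ h⁻¹) a)
  map_one' := by ext f h; simp [lpDiagonal_apply]
  map_mul' a b := by ext f h; simp [lpDiagonal_apply]
  map_zero' := by ext f h; simp [lpDiagonal_apply]
  map_add' a b := by ext f h; simp [lpDiagonal_apply]
  commutes' c := by
    ext f h
    rw [lpDiagonal_apply, Algebra.algebraMap_eq_smul_one, Algebra.algebraMap_eq_smul_one]
    simp
  map_star' a := by
    rw [ContinuousLinearMap.star_eq_adjoint]
    refine (ContinuousLinearMap.eq_adjoint_iff _ _).2 fun x y => ?_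
    rw [lp.inner_eq_tsum, lp.inner_eq_tsum]
    refine tsum_congr fun h => ?_
    rw [lpDiagonal_apply, lpDiagonal_apply, map_star, map_star,
      ContinuousLinearMap.star_eq_adjoint, ContinuousLinearMap.adjoint_inner_left]

theorem regularAlg_apply (a : A) (f : lp (fun _ : G => K) 2) (h : G) :
    regularAlg γ ρ a f h = ρ (γ h⁻¹ a) (f h) := rfl

/-- The representation `(U_g ξ)(h) = ξ(g⁻¹h)` of `G` on `ℓ²(G, K)`. -/
def regularGroup (G : Type v) [Group G] (K : Type u) [NormedAddCommGroup K]
    [InnerProductSpace ℂ K] [CompleteSpace K] :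
    G →* unitary (lp (fun _ : G => K) 2 →L[ℂ] lp (fun _ : G => K) 2) :=
  MonoidHom.mk' (fun g => Unitary.linearIsometryEquiv.symm (lpReindex (Equiv.mulLeft g⁻¹)))
    fun g g' => by
      rw [← map_mul]
      congr 1
      ext f h
      change f ((g * g')⁻¹ * h) = f (g'⁻¹ * (g⁻¹ * h))
      rw [mul_inv_rev, mul_assoc]

theorem regularGroup_apply (g : G) (f : lp (fun _ : G => K) 2) (h : G) :
    (regularGroup G K g : lp (fun _ : G => K) 2 →L[ℂ] lp (fun _ : G => K) 2) f h =
      f (g⁻¹ * h) := rfl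

instance [Nontrivial K] : Nontrivial (lp (fun _ : G => K) 2) := by
  classical
  obtain ⟨x, hx⟩ := exists_ne (0 : K)
  refine ⟨lp.single 2 1 x, 0, fun h => hx ?_⟩
  rw [← lp.single_apply_self (E := fun _ : G => K) 2 1 x, h]
  rfl

/-- The regular covariant representation induced by a representation of `A`. -/
def regularRep [Nontrivial K] : CovariantRep γ where
  H := lp (fun _ : G => K) 2
  π := regularAlg γ ρ
  U := regularGroup G K
  covariant g a := by
    have h : (regularGroup G K g : lp (fun _ : G => K) 2 →L[ℂ] lp (fun _ : G => K) 2) *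
        regularAlg γ ρ a = regularAlg γ ρ (γ g a) * regularGroup G K g := by
      ext f h
      change ρ (γ (g⁻¹ * h)⁻¹ a) (f (g⁻¹ * h)) = ρ (γ h⁻¹ (γ g a)) (f (g⁻¹ * h))
      rw [mul_inv_rev, inv_inv, map_mul]
      rfl
    rw [h, mul_assoc, Unitary.mul_star_self_of_mem (regularGroup G K g).2, mul_one]

theorem regularRep_isRegular [Nontrivial K] : (regularRep γ ρ).IsRegular :=
  ⟨K, inferInstance, inferInstance, inferInstance, ρ, LinearIsometryEquiv.refl ℂ _,
    fun _ _ _ => rfl, fun _ _ _ => rfl⟩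

theorem regularRep_admissible [Nontrivial K] (k : CrossedKind) :
    (regularRep γ ρ).Admissible k := by
  cases k with
  | full => trivial
  | reduced => exact regularRep_isRegular γ ρ

end RegularRepresentation

/-! ### Vector states, and the canonical extension of a conformal trace state -/

section VectorStates

variable {A : Type u} {G : Type v} [CStarAlgebra A] [Group G] {γ : G →* (A ≃⋆ₐ[ℂ] A)}
  {k : CrossedKind}

/-- The functional `x ↦ ⟪ξ, x_R ξ⟫` on the crossed product. -/
def vectorFunctional (R : AdmissibleRep γ k) (ξ : R.1.H) : CrossedProduct γ k →L[ℂ] ℂ :=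
  LinearMap.mkContinuous
    { toFun := fun x => ⟪ξ, (x.1 R : R.1.H →L[ℂ] R.1.H) ξ⟫_ℂ
      map_add' := fun x y => inner_add_right ξ ((x.1 R : R.1.H →L[ℂ] R.1.H) ξ)
        ((y.1 R : R.1.H →L[ℂ] R.1.H) ξ)
      map_smul' := fun c x => inner_smul_right ξ ((x.1 R : R.1.H →L[ℂ] R.1.H) ξ) c }
    (‖ξ‖ * ‖ξ‖) fun x => by
      have h1 : ‖(x.1 R : R.1.H →L[ℂ] R.1.H) ξ‖ ≤ ‖x‖ * ‖ξ‖ :=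
        (x.1 R : R.1.H →L[ℂ] R.1.H).le_of_opNorm_le
          (lp.norm_apply_le_norm ENNReal.top_ne_zero x.1 R) ξ
      calc _ ≤ ‖ξ‖ * ‖(x.1 R : R.1.H →L[ℂ] R.1.H) ξ‖ := norm_inner_le_norm (𝕜 := ℂ) _ _
        _ ≤ ‖ξ‖ * (‖x‖ * ‖ξ‖) := by gcongr
        _ = _ := by ring

theorem vectorFunctional_isState (R : AdmissibleRep γ k) {ξ : R.1.H} (hξ : ‖ξ‖ = 1) :
    IsState (vectorFunctional R ξ) := by
  refine ⟨fun x => ?_, ?_⟩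
  · have : vectorFunctional R ξ (star x * x) = ⟪ξ, (star (x.1 R : R.1.H →L[ℂ] R.1.H))
        ((x.1 R : R.1.H →L[ℂ] R.1.H) ξ)⟫_ℂ := rfl
    rw [this, ContinuousLinearMap.star_eq_adjoint, ContinuousLinearMap.adjoint_inner_right,
      inner_self_eq_norm_sq_to_K]
    exact Complex.zero_le_real.2 (sq_nonneg _) |>.trans_eq (by push_cast; rfl)
  · have : vectorFunctional R ξ 1 = ⟪ξ, ξ⟫_ℂ := rfl
    rw [this, inner_self_eq_norm_sq_to_K, hξ]
    simp

theorem vectorFunctional_monomial (R : AdmissibleRep γ k) (ξ : R.1.H) (a : A) (g : G) :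
    vectorFunctional R ξ (algIncl γ k a * canonicalUnitary γ k g) =
      ⟪ξ, R.1.π a ((R.1.U g : R.1.H →L[ℂ] R.1.H) ξ)⟫_ℂ := rfl

-- `U_g` carries `δ_1 ⊗ v` to `δ_g ⊗ v`, and `π(a)` acts fibrewise, so the inner product vanishes
-- unless `g = 1`.
open Classical in
theorem vectorFunctional_regularRep {K : Type u} [NormedAddCommGroup K] [InnerProductSpace ℂ K]
    [CompleteSpace K] [Nontrivial K] (ρ : A →⋆ₐ[ℂ] (K →L[ℂ] K)) (v : K) (a : A) (g : G) :
    vectorFunctional (k := k) ⟨regularRep γ ρ, regularRep_admissible γ ρ k⟩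
      (lp.single 2 1 v : lp (fun _ : G => K) 2)
      (algIncl γ k a * canonicalUnitary γ k g) = if g = 1 then ⟪v, ρ a v⟫_ℂ else 0 := by
  have h1 : ⟪(lp.single 2 1 v : lp (fun _ : G => K) 2), regularAlg γ ρ a
      ((regularGroup G K g : lp (fun _ : G => K) 2 →L[ℂ] _) (lp.single 2 1 v))⟫_ℂ =
        if g = 1 then ⟪v, ρ a v⟫_ℂ else 0 := by
    rw [lp.inner_single_left, regularAlg_apply, regularGroup_apply, inv_one, map_one, mul_one]
    split_ifs with hg
    · subst hg
      rw [inv_one, lp.single_apply_self]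
      rfl
    · rw [lp.single_apply_ne _ _ _ (by simpa using hg), map_zero, inner_zero_right]
  exact (vectorFunctional_monomial (k := k)
    ⟨regularRep γ ρ, regularRep_admissible γ ρ k⟩ _ a g).trans h1

theorem gnsStarAlgHom_inner_one [PartialOrder A] [StarOrderedRing A] (f : A →ₚ[ℂ] ℂ) (a : A) :
    ⟪(f.toPreGNS 1 : f.GNS), f.gnsStarAlgHom a (f.toPreGNS 1 : f.GNS)⟫_ℂ = f a := by
  change ⟪(f.toPreGNS 1 : f.GNS), f.gnsNonUnitalStarAlgHom a (f.toPreGNS 1 : f.GNS)⟫_ℂ = f a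
  rw [PositiveLinearMap.gnsNonUnitalStarAlgHom_apply_coe,
    Completion.inner_coe]
  change f (star 1 * (a * 1)) = f a
  simp

open Classical in
/-- Every state of `A` is the restriction of a state of the crossed product that vanishes on
`a u_g` for `g ≠ 1`. -/
theorem exists_isState_apply_monomial (γ : G →* (A ≃⋆ₐ[ℂ] A)) (k : CrossedKind)
    {τ : A →L[ℂ] ℂ} (hτ : IsState τ) :
    ∃ ω : CrossedProduct γ k →L[ℂ] ℂ, IsState ω ∧ ∀ (a : A) (g : G),
      ω (algIncl γ k a * canonicalUnitary γ k g) = if g = 1 then τ a else 0 := by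
  let _ := CStarAlgebra.spectralOrder A
  have _ := CStarAlgebra.spectralOrderedRing A
  have hv : ‖(hτ.toPositiveLinearMap.toPreGNS 1 : hτ.toPositiveLinearMap.GNS)‖ = 1 := by
    rw [Completion.norm_coe]
    exact hτ.toPositiveLinearMap.norm_toPreGNS_one hτ.2
  have : Nontrivial hτ.toPositiveLinearMap.GNS := 
    ⟨_, 0, fun h => zero_ne_one (norm_zero.symm.trans ((congrArg norm h).symm.trans hv))⟩
  refine ⟨vectorFunctional ⟨regularRep γ hτ.toPositiveLinearMap.gnsStarAlgHom,
    regularRep_admissible γ _ k⟩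
    (lp.single 2 1 (hτ.toPositiveLinearMap.toPreGNS 1 : hτ.toPositiveLinearMap.GNS) :
      lp (fun _ : G => hτ.toPositiveLinearMap.GNS) 2),
    vectorFunctional_isState _ ((lp.norm_single (by norm_num) 1 _).trans hv), fun a g => ?_⟩
  rw [vectorFunctional_regularRep, gnsStarAlgHom_inner_one, hτ.toPositiveLinearMap_apply]

open Classical in
/-- The canonical extension of a conformal trace state is a KMS state. -/
theorem isKMSState_of_apply_monomial {D : CentralCocycle γ} {β : ℝ} {τ : A →L[ℂ] ℂ}
    (hτ : τ ∈ conformalTraceStates D β) {ω : CrossedProduct γ k →L[ℂ] ℂ} (hω : IsState ω)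
    (h : ∀ (a : A) (g : G),
      ω (algIncl γ k a * canonicalUnitary γ k g) = if g = 1 then τ a else 0) :
    IsKMSState (cocycleFlow D k) β ω := by
  obtain ⟨-, htr, hconf⟩ := hτ
  refine isKMSState_of_monomial D hω fun a g x => ?_
  refine congrFun (Continuous.ext_on (s := (crossedSpan γ k : Set (CrossedProduct γ k)))
    (f := fun x => ω (algIncl γ k a * canonicalUnitary γ k g * x))
    (g := fun x => ω (x * (algIncl γ k a * canonicalUnitary γ k g *
      algIncl γ k (NormedSpace.exp ((β : ℂ) • D g))))) dense_crossedSpan (by fun_prop)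
    (by fun_prop) fun x hx => ?_) x
  refine crossedSpan_induction (p := fun x => ω (algIncl γ k a * canonicalUnitary γ k g * x) =
    ω (x * (algIncl γ k a * canonicalUnitary γ k g *
      algIncl γ k (NormedSpace.exp ((β : ℂ) • D g))))) (fun b h' => ?_) (by simp)
    (fun x y hx hy => by simp only [mul_add, add_mul, map_add, hx, hy])
    (fun c x hx => by simp only [mul_smul_comm, smul_mul_assoc, map_smul, hx]) hx
  rw [mul_assoc (algIncl γ k a) _ (algIncl γ k _), canonicalUnitary_mul_algIncl,
    ← mul_assoc (algIncl γ k a) (algIncl γ k _), ← map_mul (algIncl γ k), monomial_mul,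
    monomial_mul, h, h]
  -- Only `h' = g⁻¹` contributes. There `a γ_g(b) = γ_g(γ_{g⁻¹}(a) b)` brings in conformality, and
  -- the trace property with centrality of the exponential finishes.
  by_cases hgh : g * h' = 1
  · obtain rfl : h' = g⁻¹ := (inv_eq_of_mul_eq_one_right hgh).symm
    have hinv : ∀ c : A, γ g⁻¹ (γ g c) = c := fun c => by
      rw [← StarAlgEquiv.mul_apply, ← map_mul]; simp
    have hinv' : ∀ c : A, γ g (γ g⁻¹ c) = c := fun c => by
      rw [← StarAlgEquiv.mul_apply, ← map_mul]; simp
    rw [if_pos (mul_inv_cancel g), if_pos (inv_mul_cancel g)]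
    have e1 : a * γ g b = γ g (γ g⁻¹ a * b) := by rw [map_mul, hinv']
    rw [e1, hconf, map_mul (γ g⁻¹), hinv, mul_assoc, htr, mul_assoc,
      (D.exp_commute _ g _).eq, ← mul_assoc]
  · rw [if_neg hgh, if_neg fun h => hgh (mul_eq_one_comm.1 h)]

theorem exists_isKMSState_restrictToAlg_eq {D : CentralCocycle γ} {β : ℝ} (k : CrossedKind)
    {τ : A →L[ℂ] ℂ} (hτ : τ ∈ conformalTraceStates D β) :
    ∃ ω ∈ kmsStates (cocycleFlow D k) β, restrictToAlg ω = τ := by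
  obtain ⟨ω, hω, h⟩ := exists_isState_apply_monomial γ k hτ.1
  refine ⟨ω, isKMSState_of_apply_monomial hτ hω h, ?_⟩
  ext a
  rw [restrictToAlg_apply]
  simpa [canonicalUnitary_one] using h a 1

theorem restrictToAlg_image (D : CentralCocycle γ) (k : CrossedKind) (β : ℝ) :
    restrictToAlg '' kmsStates (cocycleFlow D k) β = conformalTraceStates D β := by
  refine Set.Subset.antisymm ?_ fun τ hτ => exists_isKMSState_restrictToAlg_eq k hτ
  rintro _ ⟨ω, hω, rfl⟩
  exact IsKMSState.restrictToAlg_mem hω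

end VectorStates

/-! ### Lifting extreme points -/

section WeakStar

variable {B : Type*} [CStarAlgebra B]

/-- The part of `s` lying over an extreme point of the image is a compact extreme subset of `s`.
Krein-Milman gives it an extreme point, which is then extreme in `s`. -/
theorem WeakDual.surjOn_extremePoints_comp {A : Type*} [CStarAlgebra A] (ι : A →L[ℂ] B)
    {s : Set (B →L[ℂ] ℂ)} (hs : IsCompact (WeakDual.toStrongDual ⁻¹' s)) :
    Set.SurjOn (fun ω : B →L[ℂ] ℂ => ω.comp ι) (s.extremePoints ℝ)
      (((fun ω : B →L[ℂ] ℂ => ω.comp ι) '' s).extremePoints ℝ) := by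
  have : LocallyConvexSpace ℝ (WeakDual ℂ B) :=
    inferInstanceAs (LocallyConvexSpace ℝ (WeakBilin (topDualPairing ℂ B)))
  let F : WeakDual ℂ B →L[ℝ] WeakDual ℂ A :=
    { toFun := fun ω => StrongDual.toWeakDual ((WeakDual.toStrongDual ω).comp ι)
      map_add' := fun _ _ => rfl
      map_smul' := fun _ _ => rfl
      cont := WeakDual.continuous_of_continuous_eval fun a => WeakDual.eval_continuous (ι a) }
  exact _root_.surjOn_extremePoints_image F.toContinuousAffineMap hs

end WeakStar

/-! ### Weak-* compactness of the KMS states; extremal extensions -/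

section Extension

variable {A : Type u} {G : Type v} [CStarAlgebra A] [Group G] {γ : G →* (A ≃⋆ₐ[ℂ] A)}
  {k : CrossedKind} {D : CentralCocycle γ} {β : ℝ}

/-- This replaces the existential over subalgebras by conditions that are each weak-* closed in `ω`.
-/
theorem mem_kmsStates_cocycleFlow_iff {ω : CrossedProduct γ k →L[ℂ] ℂ} :
    ω ∈ kmsStates (cocycleFlow D k) β ↔ ((∀ b, 0 ≤ ω (star b * b)) ∧ ω 1 = 1) ∧
      ∀ (a : A) (g : G) (x : CrossedProduct γ k),
        ω (algIncl γ k a * canonicalUnitary γ k g * x) =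
          ω (x * (algIncl γ k a * canonicalUnitary γ k g *
            algIncl γ k (NormedSpace.exp ((β : ℂ) • D g)))) :=
  ⟨fun h => ⟨h.1, fun a g x => h.monomial_mul D a g x⟩,
    fun h => isKMSState_of_monomial D h.1 h.2⟩

theorem isCompact_kmsStates_cocycleFlow :
    IsCompact (WeakDual.toStrongDual ⁻¹' kmsStates (cocycleFlow D k) β) := by
  refine (WeakDual.isCompact_closedBall 0 1).of_isClosed_subset ?_ fun ω hω => ?_
  · have he : ∀ b : CrossedProduct γ k, Continuous fun ω : WeakDual ℂ (CrossedProduct γ k) =>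
        WeakDual.toStrongDual ω b := fun b => WeakDual.eval_continuous b
    have : WeakDual.toStrongDual ⁻¹' kmsStates (cocycleFlow D k) β =
        {ω : WeakDual ℂ (CrossedProduct γ k) |
          ((∀ b, 0 ≤ WeakDual.toStrongDual ω (star b * b)) ∧ WeakDual.toStrongDual ω 1 = 1) ∧
          ∀ (a : A) (g : G) (x : CrossedProduct γ k),
            WeakDual.toStrongDual ω (algIncl γ k a * canonicalUnitary γ k g * x) =
              WeakDual.toStrongDual ω (x * (algIncl γ k a * canonicalUnitary γ k g *
                algIncl γ k (NormedSpace.exp ((β : ℂ) • D g))))} :=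
      Set.ext fun ω => mem_kmsStates_cocycleFlow_iff
    rw [this]
    simp only [Set.ofPred_and, Set.ofPred_forall]
    refine ((isClosed_iInter fun b => isClosed_le continuous_const (he _)).inter
      (isClosed_eq (he _) continuous_const)).inter ?_
    exact isClosed_iInter fun a => isClosed_iInter fun g => isClosed_iInter fun x =>
      isClosed_eq (he _) (he _)
  · rw [Set.mem_preimage, mem_closedBall_zero_iff]
    exact ContinuousLinearMap.opNorm_le_bound _ zero_le_one fun b => by
      rw [one_mul]; exact hω.1.norm_apply_le b

theorem surjOn_restrictToAlg_extremePoints (D : CentralCocycle γ) (k : CrossedKind) (β : ℝ) :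
    Set.SurjOn restrictToAlg ((kmsStates (cocycleFlow D k) β).extremePoints ℝ)
      ((conformalTraceStates D β).extremePoints ℝ) := by
  rw [← restrictToAlg_image D k β]
  exact WeakDual.surjOn_extremePoints_comp _ isCompact_kmsStates_cocycleFlow

end Extension

/-! ### Decompositions of `ω|_A` lift to decompositions of `ω` -/

section Decomposition

theorem IsState.norm_apply_mul_le {B : Type*} [CStarAlgebra B] {ω : B →L[ℂ] ℂ} (hω : IsState ω)
    (x y : B) : ‖ω (x * y)‖ ≤ √(ω (x * star x)).re * ‖y‖ := by
  let _ := CStarAlgebra.spectralOrder B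
  have _ := CStarAlgebra.spectralOrderedRing B
  have h := hω.toPositiveLinearMap.norm_apply_star_mul_le (star x) y
  rw [PositiveLinearMap.preGNS_norm_def _ (PositiveLinearMap.toPreGNS _ (star x)),
    PositiveLinearMap.ofPreGNS_toPreGNS, star_star] at h
  exact h.trans (by gcongr; exacts [le_rfl, hω.toPositiveLinearMap.norm_toPreGNS_le hω.2 y])

variable {A : Type u} {G : Type v} [CStarAlgebra A] [Group G] {γ : G →* (A ≃⋆ₐ[ℂ] A)}
  {k : CrossedKind} {D : CentralCocycle γ} {β : ℝ} {τ σ : A →L[ℂ] ℂ}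

theorem apply_inv_apply (γ : G →* (A ≃⋆ₐ[ℂ] A)) (g : G) (a : A) : γ g (γ g⁻¹ a) = a := by
  rw [← StarAlgEquiv.mul_apply, ← map_mul, mul_inv_cancel, map_one]
  rfl

section Order

variable [PartialOrder A] [StarOrderedRing A]

/-- The action is bounded in the norm of `L²(A, τ)`. -/
theorem norm_toPreGNS_action_le (hτ : IsState τ) (hD : τ ∈ conformalTraceStates D β) (g : G)
    (a : A) : ‖hτ.toPositiveLinearMap.toPreGNS (γ g a)‖ ≤
      √‖NormedSpace.exp ((β : ℂ) • D g)‖ * ‖hτ.toPositiveLinearMap.toPreGNS a‖ := by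
  rw [← sq_le_sq₀ (by positivity) (by positivity), mul_pow, Real.sq_sqrt (norm_nonneg _),
    PositiveLinearMap.norm_toPreGNS_sq, ← map_star, ← map_mul, hτ.toPositiveLinearMap_apply,
    hD.2.2, mul_assoc, ← hτ.toPositiveLinearMap_apply]
  refine (Complex.re_le_norm _).trans
    ((hτ.toPositiveLinearMap.norm_apply_star_mul_le _ _).trans ?_)
  rw [sq, mul_left_comm]
  gcongr
  exact hτ.toPositiveLinearMap.norm_toPreGNS_mul_right_le hD.2.1 _ _

theorem tendsto_inner_toPreGNS (hτ : IsState τ) (hD : τ ∈ conformalTraceStates D β) {a : ℕ → A}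
    {φ : A → ℂ} (h : ∀ x, Tendsto (fun n => τ (a n * x)) atTop (𝓝 (φ x)))
    (y : hτ.toPositiveLinearMap.PreGNS) :
    Tendsto (fun n => ⟪y, hτ.toPositiveLinearMap.toPreGNS (a n)⟫_ℂ) atTop
      (𝓝 (φ (star (hτ.toPositiveLinearMap.ofPreGNS y)))) :=
  (h _).congr fun _ => hD.2.1 _ _

/-- If `σ` is the limit of `τ(a_n ·)`, then `(a_n)` asymptotically commutes with `c u_g`. -/
theorem tendsto_toPreGNS_commutator (hτ : IsState τ) (hD : τ ∈ conformalTraceStates D β)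
    (hσ : σ ∈ conformalTraceStates D β) {a : ℕ → A}
    (ha : CauchySeq fun n => hτ.toPositiveLinearMap.toPreGNS (a n))
    (h : ∀ x, Tendsto (fun n => τ (a n * x)) atTop (𝓝 (σ x))) (c : A) (g : G) :
    Tendsto (fun n => hτ.toPositiveLinearMap.toPreGNS (a n * c - c * γ g (a n))) atTop (𝓝 0) := by
  set f := hτ.toPositiveLinearMap with hf
  refine tendsto_zero_of_cauchySeq_of_inner ?_ fun y => ?_
  -- `x ↦ xc - cγ_g(x)` is bounded in 2-norm, so it preserves Cauchy sequences; weak convergence to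
  -- zero then suffices.
  · let T : f.PreGNS →ₗ[ℂ] f.PreGNS :=
      { toFun := fun x => f.toPreGNS (f.ofPreGNS x * c - c * γ g (f.ofPreGNS x))
        map_add' := fun x y => by
          rw [← map_add]
          congr 1
          simp only [map_add, add_mul, mul_add]
          abel
        map_smul' := fun r x => by
          rw [RingHom.id_apply, ← map_smul]
          congr 1
          simp only [map_smul, smul_mul_assoc, mul_smul_comm, smul_sub] }
    let T' : f.PreGNS →L[ℂ] f.PreGNS := T.mkContinuous
      (‖c‖ + ‖c‖ * √‖NormedSpace.exp ((β : ℂ) • D g)‖) fun x => by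
        change ‖f.toPreGNS (f.ofPreGNS x * c) - f.toPreGNS (c * γ g (f.ofPreGNS x))‖ ≤ _
        rw [add_mul, mul_assoc]
        refine (norm_sub_le _ _).trans (add_le_add ?_ ?_)
        · exact f.norm_toPreGNS_mul_right_le hD.2.1 _ _
        · refine (f.norm_toPreGNS_mul_le _ _).trans ?_
          gcongr
          exact norm_toPreGNS_action_le hτ hD g _
    exact T'.uniformContinuous.comp_cauchySeq ha
  · set e := NormedSpace.exp ((β : ℂ) • D g)
    have h1 : ∀ x, Tendsto (fun n => τ ((a n * c - c * γ g (a n)) * x)) atTop (𝓝 0) := by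
      intro x
      have e1 : ∀ n, τ ((a n * c - c * γ g (a n)) * x) =
          τ (a n * (c * x)) - τ (a n * (e * γ g⁻¹ (x * c))) := fun n => by
        have e2 : τ (c * γ g (a n) * x) = τ (a n * (e * γ g⁻¹ (x * c))) := by
          rw [hD.2.1, ← mul_assoc x]
          nth_rw 1 [← apply_inv_apply γ g (x * c)]
          rw [← map_mul, hD.2.2, mul_assoc, hD.2.1, mul_assoc]
        rw [sub_mul, map_sub, e2, mul_assoc]
      -- The two limits agree because `σ` itself is a conformal trace.
      have e3 : σ (c * x) = σ (e * γ g⁻¹ (x * c)) := by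
        rw [hσ.2.1 e, ← hσ.2.2, apply_inv_apply, hσ.2.1]
      simp only [e1]
      have := (h (c * x)).sub (h (e * γ g⁻¹ (x * c)))
      rwa [e3, sub_self] at this
    exact tendsto_inner_toPreGNS hτ hD (φ := fun _ => 0) h1 y

/-- Cauchy-Schwarz produces `ω(aa⋆)`, and traciality on `A` turns it into the square of the 2-norm
of `a`. Thus `ω(a ·)` depends continuously on `a` in 2-norm. -/
theorem norm_apply_algIncl_mul_le {ω : CrossedProduct γ k →L[ℂ] ℂ}
    (hω : ω ∈ kmsStates (cocycleFlow D k) β) (hτ : IsState (restrictToAlg ω)) (a : A)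
    (x : CrossedProduct γ k) :
    ‖ω (algIncl γ k a * x)‖ ≤ ‖hτ.toPositiveLinearMap.toPreGNS a‖ * ‖x‖ := by
  refine (hω.1.norm_apply_mul_le _ _).trans (le_of_eq ?_)
  rw [← map_star, ← map_mul, ← hτ.toPositiveLinearMap.norm_toPreGNS_star hω.restrictToAlg_mem.2.1,
    PositiveLinearMap.preGNS_norm_def, PositiveLinearMap.ofPreGNS_toPreGNS, star_star]
  rfl

theorem tendsto_apply_algIncl_mul {ω : CrossedProduct γ k →L[ℂ] ℂ}
    (hω : ω ∈ kmsStates (cocycleFlow D k) β) (hτ : IsState (restrictToAlg ω)) {z : ℕ → A}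
    (hz : Tendsto (fun n => hτ.toPositiveLinearMap.toPreGNS (z n)) atTop (𝓝 0))
    (x : CrossedProduct γ k) :
    Tendsto (fun n => ω (algIncl γ k (z n) * x)) atTop (𝓝 0) := by
  refine squeeze_zero_norm (fun n => norm_apply_algIncl_mul_le hω hτ (z n) x) ?_
  simpa using (tendsto_zero_iff_norm_tendsto_zero.1 hz).mul_const ‖x‖

theorem tendsto_apply_commutator {ω : CrossedProduct γ k →L[ℂ] ℂ}
    (hω : ω ∈ kmsStates (cocycleFlow D k) β) (hτ : IsState (restrictToAlg ω))
    (hσ : σ ∈ conformalTraceStates D β) {a : ℕ → A}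
    (ha : CauchySeq fun n => hτ.toPositiveLinearMap.toPreGNS (a n))
    (h : ∀ x, Tendsto (fun n => restrictToAlg ω (a n * x)) atTop (𝓝 (σ x)))
    {y : CrossedProduct γ k} (hy : y ∈ crossedSpan γ k) (x : CrossedProduct γ k) :
    Tendsto (fun n => ω (algIncl γ k (a n) * y * x) - ω (y * algIncl γ k (a n) * x))
      atTop (𝓝 0) := by
  refine crossedSpan_induction (p := fun y => Tendsto (fun n =>
    ω (algIncl γ k (a n) * y * x) - ω (y * algIncl γ k (a n) * x)) atTop (𝓝 0))
    (fun c g => ?_) (by simp) (fun y y' hy hy' => ?_) (fun r y hy => ?_) hy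
  · refine (tendsto_apply_algIncl_mul hω hτ (tendsto_toPreGNS_commutator hτ
      hω.restrictToAlg_mem hσ ha h c g) (canonicalUnitary γ k g * x)).congr fun n => ?_
    rw [mul_assoc (algIncl γ k c) _ (algIncl γ k _), canonicalUnitary_mul_algIncl, ← map_sub]
    congr 1
    simp only [map_sub, map_mul, sub_mul, mul_assoc]
  · simpa only [mul_add, add_mul, map_add, add_sub_add_comm, add_zero] using hy.add hy'
  · simpa only [mul_smul_comm, smul_mul_assoc, map_smul, ← smul_sub, smul_zero] using
      hy.const_smul r

/-- A conformal trace state dominated by the restriction of a KMS state `ω` extends to a KMS state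
that is a limit of functionals `ω(a_n ·)`. -/
theorem exists_isKMSState_of_le {ω : CrossedProduct γ k →L[ℂ] ℂ}
    (hω : ω ∈ kmsStates (cocycleFlow D k) β) (hτ : IsState (restrictToAlg ω))
    (hσ : σ ∈ conformalTraceStates D β) {C : ℝ}
    (hC : ∀ a, (σ (star a * a)).re ≤ C * (restrictToAlg ω (star a * a)).re) :
    ∃ ω' ∈ kmsStates (cocycleFlow D k) β, restrictToAlg ω' = σ ∧ ∃ a : ℕ → A,
      CauchySeq (fun n => hτ.toPositiveLinearMap.toPreGNS (a n)) ∧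
      (∀ x, Tendsto (fun n => restrictToAlg ω (a n * x)) atTop (𝓝 (σ x))) ∧
      ∀ x, Tendsto (fun n => ω (algIncl γ k (a n) * x)) atTop (𝓝 (ω' x)) := by
  set f := hτ.toPositiveLinearMap
  have hbound : ∀ a, ‖σ a‖ ≤ √C * ‖f.toPreGNS a‖ := by
    intro a
    let f' := hσ.1.toPositiveLinearMap
    have h1 : ‖σ a‖ ≤ ‖f'.toPreGNS a‖ := by
      have := f'.norm_apply_star_mul_le 1 a
      rwa [star_one, one_mul, f'.norm_toPreGNS_one hσ.1.2, one_mul] at this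
    refine h1.trans (abs_le_of_sq_le_sq' ?_ (by positivity)).2
    rw [mul_pow, f'.norm_toPreGNS_sq, f.norm_toPreGNS_sq]
    rcases le_total 0 C with h0 | h0
    · rw [Real.sq_sqrt h0]
      exact hC a
    -- For `C ≤ 0` the square root is zero, but domination then forces `σ(a⋆a)` to have nonpositive
    -- real part.
    · rw [Real.sqrt_eq_zero_of_nonpos h0]
      have h2 : 0 ≤ (f (star a * a)).re := by
        rw [← f.norm_toPreGNS_sq]
        positivity
      have h3 : (f' (star a * a)).re ≤ C * (f (star a * a)).re := hC a
      nlinarith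
  obtain ⟨a, ha0, ha, hlim⟩ := f.exists_seq_nonneg_tendsto hω.restrictToAlg_mem.2.1 σ.toLinearMap
    (fun a ha => hσ.1.nonneg ha) hbound
  -- The functionals `ω(a_n ·)` are norm Cauchy, as images of a 2-norm Cauchy sequence under a
  -- bounded map.
  let L : f.PreGNS →L[ℂ] (CrossedProduct γ k →L[ℂ] ℂ) :=
    LinearMap.mkContinuous
      { toFun := fun x => ω.comp (ContinuousLinearMap.mul ℂ _ (algIncl γ k (f.ofPreGNS x)))
        map_add' := fun x y => by ext b; simp
        map_smul' := fun r x => by ext b; simp }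
      1 fun x => by
        refine ContinuousLinearMap.opNorm_le_bound _ (by positivity) fun b => ?_
        rw [one_mul]
        exact norm_apply_algIncl_mul_le hω hτ _ b
  obtain ⟨ω', hω'⟩ := cauchySeq_tendsto_of_complete (L.uniformContinuous.comp_cauchySeq ha)
  have hpt : ∀ x, Tendsto (fun n => ω (algIncl γ k (a n) * x)) atTop (𝓝 (ω' x)) := fun x =>
    ((ContinuousLinearMap.apply ℂ ℂ x).continuous.tendsto ω').comp hω'
  have hres : restrictToAlg ω' = σ := by
    ext x
    refine tendsto_nhds_unique (hpt (algIncl γ k x)) ?_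
    simp only [← map_mul (algIncl γ k)]
    exact hlim x
  refine ⟨ω', mem_kmsStates_cocycleFlow_iff.2 ⟨⟨fun b => ?_, ?_⟩, fun c g x => ?_⟩, hres, a, ha,
    hlim, hpt⟩
  · have hcl : IsClosed {b | 0 ≤ ω' (star b * b)} :=
      isClosed_le continuous_const (by fun_prop)
    refine hcl.closure_subset_iff.2 (fun y hy => ?_) (dense_crossedSpan b)
    -- Up to a vanishing commutator `ω(a_n y⋆y)` equals `ω(y⋆ a_n y)`, which is nonnegative since
    -- `a_n = d⋆d`.
    have h1 := (hpt (star y * y)).sub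
      (tendsto_apply_commutator hω hτ hσ ha hlim (star_mem_crossedSpan hy) y)
    rw [sub_zero] at h1
    refine ge_of_tendsto' h1 fun n => ?_
    obtain ⟨d, hd⟩ := CStarAlgebra.nonneg_iff_eq_star_mul_self.1 (ha0 n)
    rw [mul_assoc (algIncl γ k (a n)), sub_sub_cancel, hd]
    convert hω.1.1 (algIncl γ k d * y) using 2
    simp only [map_mul, map_star, star_mul, mul_assoc]
  · have := congrFun (congrArg DFunLike.coe hres) 1
    rwa [restrictToAlg_apply, map_one, hσ.1.2] at this
  · have h1 := tendsto_apply_commutator hω hτ hσ ha hlim (monomial_mem_crossedSpan c g) x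
    -- The KMS condition for `ω` moves `c u_g` past `a_n x` in the second term, exposing the defect
    -- of the KMS condition for `ω'`; the commutator estimate makes it zero.
    have h2 : Tendsto (fun n => ω (algIncl γ k (a n) * (algIncl γ k c * canonicalUnitary γ k g) * x)
        - ω (algIncl γ k c * canonicalUnitary γ k g * algIncl γ k (a n) * x)) atTop
        (𝓝 (ω' (algIncl γ k c * canonicalUnitary γ k g * x) -
          ω' (x * (algIncl γ k c * canonicalUnitary γ k g *
            algIncl γ k (NormedSpace.exp ((β : ℂ) • D g)))))) := by
      refine ((hpt _).sub (hpt _)).congr fun n => ?_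
      rw [mul_assoc (algIncl γ k (a n)) (algIncl γ k c * canonicalUnitary γ k g) x,
        mul_assoc (algIncl γ k c * canonicalUnitary γ k g) (algIncl γ k (a n)) x,
        hω.monomial_mul D c g, mul_assoc (algIncl γ k (a n)) x]
    exact sub_eq_zero.1 (tendsto_nhds_unique h2 h1)

end Order

/-- Each summand of a convex decomposition of `ω|_A` is dominated by a multiple of it, so both
summands extend to KMS states; the choice of extensions as limits of `ω(a_n ·)` is what makes them
recombine to `ω`. -/
theorem restrictToAlg_mem_extremePoints {ω : CrossedProduct γ k →L[ℂ] ℂ}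
    (hω : ω ∈ (kmsStates (cocycleFlow D k) β).extremePoints ℝ) :
    restrictToAlg ω ∈ (conformalTraceStates D β).extremePoints ℝ := by
  let _ := CStarAlgebra.spectralOrder A
  have _ := CStarAlgebra.spectralOrderedRing A
  obtain ⟨hω, hext⟩ := mem_extremePoints_iff_left.1 hω
  have hD : restrictToAlg ω ∈ conformalTraceStates D β := IsKMSState.restrictToAlg_mem hω
  have hτ : IsState (restrictToAlg ω) := hD.1
  refine mem_extremePoints_iff_left.2 ⟨hD, fun σ₁ hσ₁ σ₂ hσ₂ hseg => ?_⟩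
  obtain ⟨s, t, hs, ht, hst, hsum⟩ := hseg
  have hsum' : ∀ a, restrictToAlg ω a = s * σ₁ a + t * σ₂ a := fun a => by
    rw [← hsum]
    simp
  have hdom : ∀ {r r' : ℝ} {φ φ' : A →L[ℂ] ℂ}, 0 < r → 0 < r' → IsState φ' →
      (∀ a, restrictToAlg ω a = r * φ a + r' * φ' a) →
      ∀ a, (φ (star a * a)).re ≤ r⁻¹ * (restrictToAlg ω (star a * a)).re := by
    intro r r' φ φ' hr hr' hφ' h a
    rw [h, ← div_eq_inv_mul, le_div_iff₀ hr]
    have := (Complex.le_def.1 (hφ'.1 a)).1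
    simp only [Complex.add_re, Complex.re_ofReal_mul, Complex.zero_re] at this ⊢
    nlinarith [mul_nonneg hr'.le this]
  obtain ⟨ω₁, hω₁, hres₁, a₁, hc₁, hl₁, hp₁⟩ := exists_isKMSState_of_le hω hτ hσ₁
    (hdom hs ht hσ₂.1 hsum')
  obtain ⟨ω₂, hω₂, -, a₂, hc₂, hl₂, hp₂⟩ := exists_isKMSState_of_le hω hτ hσ₂
    (hdom ht hs hσ₁.1 fun a => by rw [hsum', add_comm])
  -- The densities add up to `1` weakly because the functionals add up to `ω|_A`; being Cauchy, they
  -- do so in 2-norm.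
  have hz : Tendsto (fun n => hτ.toPositiveLinearMap.toPreGNS
      ((s : ℂ) • a₁ n + (t : ℂ) • a₂ n - 1)) atTop (𝓝 0) := by
    refine tendsto_zero_of_cauchySeq_of_inner ?_ fun y => ?_
    · simp only [map_add, map_smul, sub_eq_add_neg]
      exact (((uniformContinuous_const_smul (s : ℂ)).comp_cauchySeq hc₁).add
        ((uniformContinuous_const_smul (t : ℂ)).comp_cauchySeq hc₂)).add_const
    · refine tendsto_inner_toPreGNS hτ hD (φ := fun _ => 0) (fun x => ?_) y
      have := (((hl₁ x).const_mul (s : ℂ)).add ((hl₂ x).const_mul (t : ℂ))).sub_const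
        (restrictToAlg ω x)
      rw [← hsum', sub_self] at this
      refine this.congr fun n => ?_
      simp only [sub_mul, add_mul, smul_mul_assoc, map_sub, map_add, map_smul, one_mul,
        smul_eq_mul]
  have hω12 : s • ω₁ + t • ω₂ = ω := by
    ext x
    have h1 := tendsto_apply_algIncl_mul hω hτ hz x
    have h2 := (((hp₁ x).const_mul (s : ℂ)).add ((hp₂ x).const_mul (t : ℂ))).sub_const (ω x)
    have h3 := tendsto_nhds_unique h1 (h2.congr fun n => by
      simp only [map_sub, map_add, map_smul, map_one, sub_mul, add_mul, smul_mul_assoc, one_mul,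
        smul_eq_mul])
    have h4 := sub_eq_zero.1 h3.symm
    simpa using h4
  rw [← hres₁, hext ω₁ hω₁ ω₂ hω₂ ⟨s, t, hs, ht, hst, hω12⟩]

end Decomposition
end
/-- Restriction to `A` maps the extremal `β`-KMS states of the flow `α^D` on the (full or
reduced) crossed product `A ⋊_γ G` to extremal points of `T_β(A)`, and every extremal point of
`T_β(A)` is the restriction of an extremal `β`-KMS state. -/
theorem mainTheorem7 {A : Type*} {G : Type*} [CStarAlgebra A] [TopologicalSpace.SeparableSpace A]
    [Group G] [Countable G] (γ : G →* (A ≃⋆ₐ[ℂ] A)) (D : CentralCocycle γ) (k : CrossedKind)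
    (β : ℝ) :
    (∀ ω ∈ (kmsStates (cocycleFlow D k) β).extremePoints ℝ,
      restrictToAlg ω ∈ (conformalTraceStates D β).extremePoints ℝ) ∧
    ∀ τ ∈ (conformalTraceStates D β).extremePoints ℝ,
      ∃ ω ∈ (kmsStates (cocycleFlow D k) β).extremePoints ℝ, restrictToAlg ω = τ :=
  ⟨fun _ hω => restrictToAlg_mem_extremePoints hω,
    fun _ hτ => surjOn_restrictToAlg_extremePoints D k β hτ⟩
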